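/- For real parameters $a,b$ let $\Lambda=\Lambda_{a,b}(x,y)=(-a|x|-by+(a-b-1),\,x)$ be the Lozi map and, for $\sigma\in\{-1,+1\}$ (also written $-$ and $+$), let $\Lambda_\sigma(x,y)=(-\sigma a x-by+(a-b-1),\,x)$ be its affine branches. For $\overline b\in(0,1)$ let $P(\overline b)=\{(a,b): a>3b+1,\ 0\le b\le\overline b\}$. *Symbolic dynamics.* For a finite word $I=(I_1,\dots,I_N)$ in $\{-1,+1\}$ put $\Lambda_I=\Lambda_{I_N}\circ\cdots\circ\Lambda_{I_1}$. A point $\theta$ is a formal $I$-periodic point if $\Lambda_I(\theta)=\theta$; it is $I$-admissible if $I_{k+1}\cdot\pi_1(\Lambda_{(I_1,\dots,I_k)}(\theta))\ge 0$ for $0\le k<N$, where $\pi_1(x,y)=x$; a formal $I$-periodic point is hyperbolic if it is $I$-admissible and $\pi_1(\Lambda^k(\theta))\neq0$ for $0\le k<N$. For $m,n\ge2$ let $\iota_{\sigma,m,n}=(+\,(-)^{m-2}\,+\,+\,(-)^{n-2}\,\sigma)$, a word of length $m+n$, and for $(a,b)\in P(\overline b)$ let $\theta_{\sigma,m,n}=\theta_{\sigma,m,n}(a,b)$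 be the formal $\iota_{\sigma,m,n}$-periodic point, which exists and is unique. The parameter $(a,b)$ is an $\iota_{\pm,m,n}$-bifurcation parameter if some point $\theta$ is a formal periodic point for both $\iota_{-,m,n}$ and $\iota_{+,m,n}$, is admissible for both, and satisfies $\pi_1(\Lambda^{m+n-1}(\theta))=0$. *Vertical strips.* Put $\lambda=\frac{a+\sqrt{a^2-4b}}2$, $\mu=b/\lambda$, $z_+=(\zeta_+,\zeta_+)$ with $\zeta_+=1-\frac{2(b+1)}{a+b+1}$ (a saddle fixed point), and $W^S(z_+)=\{w:\Lambda^k(w)\to z_+\}$. A vertical segment is the graph $\{(h(y),y):y\in[-1,1]\}$ of an affine function $h$, and for vertical segments $\alpha,\beta$ let $V(\alpha,\beta)$ be the closed region of $\mathbb R\times[-1,1]$ between them. For $\omega\subset\mathbb R^2$ let $\Pi_\sigma(\omega)=\Lambda_\sigma^{-1}(\omega)\cap(\mathbb R\times[-1,1])$. Let $\beta_1$ be the intersection with $\mathbb R\times[-1,1]$ of the maximal line segment of $W^S(z_+)$ through $z_+$ (its direction is $(-\mu,1)$), $\beta_k=\Pi_-(\beta_{k-1})$ for $k\ge2$, and $\gamma_k=\Pi_+(\beta_k)$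 for $k\ge1$. For $m,n\ge2$ let $C_m=V(\gamma_{m-1},\gamma_m)$ and $C_{m,n}=\{v\in C_m:\Lambda^m(v)\in C_n\}$. If $C_{m,n}$ is the union of two disjoint vertical strips bounded by vertical segments contained in $W^S(z_+)$, let $C^L_{m,n}$ be the left one. **Statement.** There exist $\overline b\in(0,1)$, an integer $M\ge5$ and, for all $m\ge M$ and $n\in\{2,3\}$, an analytic function $l_{m,n}:[0,\overline b]\to(\sqrt2,4)$ whose graph $\{(l_{m,n}(b),b)\}$ lies in $P(\overline b)$, such that for all $m\ge M$ the following hold. For all $n\in\{2,3\}$, $\sigma\in\{-1,+1\}$ and $(a,b)\in P(\overline b)$: 1. if $a>l_{m,n}(b)$, then $\theta_{\sigma,m,n}$ is hyperbolic, $C^L_{m,n}$ exists and $\theta_{\sigma,m,n}\in C^L_{m,n}$; 2. if $a=l_{m,n}(b)$, then $(a,b)$ is an $\iota_{\pm,m,n}$-bifurcation parameter; moreover $\theta_{\sigma,m,n}$ is admissible, $C^L_{m,n}$ exists, $\theta_{-,m,n}=\theta_{+,m,n}\in C^L_{m,n}$, and $\pi_1(\Lambda^{m+n-1}(\theta_{\sigma,m,n}))=0$;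 3. if $a<l_{m,n}(b)$, then $\theta_{\sigma,m,n}$ is not admissible. Furthermore, $$\frac{d\,l_{m,2}}{db}(b)>\frac{d\,l_{m,3}}{db}(b)\qquad\text{for all } b\in[0,\overline b],$$ where the derivatives at the end points are one-sided. -/

import Mathlib

open Set Filter Topology

noncomputable section

namespace Lozi

/-! ## The Lozi family and its parameter spaces

The sign set `S = {-1, +1}` is `ℤˣ`; the phase space is `ℝ × ℝ`. -/

/-- The Lozi map `Λ(x, y) = (-a|x| - b y + (a - b - 1), x)`. -/
def lozi (a b : ℝ) (v : ℝ × ℝ) : ℝ × ℝ :=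
  (-a * |v.1| - b * v.2 + (a - b - 1), v.1)

/-- The affine branch `Λ_σ(x, y) = (-σ a x - b y + (a - b - 1), x)`. -/
def branch (a b : ℝ) (σ : ℤˣ) (v : ℝ × ℝ) : ℝ × ℝ :=
  (-((σ : ℤ) : ℝ) * a * v.1 - b * v.2 + (a - b - 1), v.1)

/-- The parameters `a > 3b + 1`, `0 ≤ b ≤ 1`, for which the renormalization model exists. -/
def Pmod : Set (ℝ × ℝ) := {q | 3 * q.2 + 1 < q.1 ∧ 0 ≤ q.2 ∧ q.2 ≤ 1}

/-- The neighborhood `Pmod ∩ {0 ≤ b ≤ bbar}` of the tent family. -/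
def Pnbd (bbar : ℝ) : Set (ℝ × ℝ) := Pmod ∩ {q | 0 ≤ q.2 ∧ q.2 ≤ bbar}

/-! ## Symbolic dynamics and formal periodic points -/

/-- `Λ_I = Λ_{I_N} ∘ ⋯ ∘ Λ_{I_1}` for a finite itinerary `I = (I_1, …, I_N)`. -/
def formalMap (a b : ℝ) (I : List ℤˣ) (v : ℝ × ℝ) : ℝ × ℝ :=
  I.foldl (fun w σ => branch a b σ w) v

/-- `θ = Λ_I(θ)`. -/
def IsFormalPeriodic (a b : ℝ) (I : List ℤˣ) (θ : ℝ × ℝ) : Prop :=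
  formalMap a b I θ = θ

/-- `θ` is `I`-admissible: the `x`-coordinate of `Λ_{(I_1, …, I_k)}(θ)` lies in
`I_{k+1} [0, ∞)` for `0 ≤ k < l(I)`. -/
def Admissible (a b : ℝ) (I : List ℤˣ) (θ : ℝ × ℝ) : Prop :=
  ∀ (k : ℕ) (hk : k < I.length), 0 ≤ ((I[k] : ℤ) : ℝ) * (formalMap a b (I.take k) θ).1

/-- A formal `I`-periodic point is hyperbolic if it is `I`-admissible and its orbit under the
Lozi map avoids the critical locus `x = 0`. -/
def Hyperbolic (a b : ℝ) (I : List ℤˣ) (θ : ℝ × ℝ) : Prop :=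
  IsFormalPeriodic a b I θ ∧ Admissible a b I θ ∧
    ∀ k < I.length, ((lozi a b)^[k] θ).1 ≠ 0

/-- The formal `I`-periodic point at the parameter `(a, b)`. It exists and is unique when
`a > b + 1` and `0 ≤ b ≤ 1`; if there is none, the value is arbitrary. -/
def formalPoint (a b : ℝ) (I : List ℤˣ) : ℝ × ℝ :=
  Classical.epsilon (IsFormalPeriodic a b I)

/-- `(a, b)` is a bifurcation parameter of the two itineraries `J-` and `J+`: at `(a, b)` there is
a formal `J±`-periodic point that is admissible for both itineraries and whose orbit lies on
the critical locus `x = 0` at the position of the symbol `±`. -/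
def IsBifurcationParameter (a b : ℝ) (J : List ℤˣ) : Prop :=
  ∃ θ : ℝ × ℝ,
    (∀ σ : ℤˣ, IsFormalPeriodic a b (J ++ [σ]) θ ∧ Admissible a b (J ++ [σ]) θ) ∧
      ((lozi a b)^[J.length] θ).1 = 0

/-- The itinerary `(+ (-)^{m-2} + + (-)^{n-2})`, of length `m + n - 1`. -/
def iotaStem (m n : ℕ) : List ℤˣ :=
  [1] ++ List.replicate (m - 2) (-1) ++ [1, 1] ++ List.replicate (n - 2) (-1)

/-- The itinerary `ι_{σ,m,n} = (+ (-)^{m-2} + + (-)^{n-2} σ)`, of length `m + n`. -/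
def iota (σ : ℤˣ) (m n : ℕ) : List ℤˣ := iotaStem m n ++ [σ]

/-- `θ_{σ,m,n}`, the formal `ι_{σ,m,n}`-periodic point. -/
def theta (a b : ℝ) (σ : ℤˣ) (m n : ℕ) : ℝ × ℝ := formalPoint a b (iota σ m n)

/-! ## The renormalization model -/

/-- `λ = (a + √(a² - 4b)) / 2`. -/
def lam (a b : ℝ) : ℝ := (a + √(a ^ 2 - 4 * b)) / 2

/-- `μ = b / λ`. -/
def mu (a b : ℝ) : ℝ := b / lam a b

/-- The saddle fixed points `z_σ = (ζ_σ, ζ_σ)`, where `ζ_- = -1` and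
`ζ_+ = 1 - 2(b + 1)/(a + b + 1)`. -/
def fixedPoint (a b : ℝ) (σ : ℤˣ) : ℝ × ℝ :=
  if σ = 1 then (1 - 2 * (b + 1) / (a + b + 1), 1 - 2 * (b + 1) / (a + b + 1)) else (-1, -1)

/-- The stable set (stable manifold) `W^S(z)` of a fixed point `z`. -/
def stableSet (a b : ℝ) (z : ℝ × ℝ) : Set (ℝ × ℝ) :=
  {w | Tendsto (fun k : ℕ => (lozi a b)^[k] w) atTop (𝓝 z)}

/-- `W_0^S(z_σ)`, the line segment of `W^S(z_σ)` containing `z_σ`: the largest segment through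
`z_σ` in the contracting direction `(-σ μ, 1)` that is contained in `W^S(z_σ)`. -/
def stableSegment (a b : ℝ) (σ : ℤˣ) : Set (ℝ × ℝ) :=
  {w | (∃ t : ℝ, w = fixedPoint a b σ + t • (-((σ : ℤ) : ℝ) * mu a b, (1 : ℝ))) ∧
    segment ℝ (fixedPoint a b σ) w ⊆ stableSet a b (fixedPoint a b σ)}

/-- The horizontal strip `ℝ × I^V`, where `I^V = [-1, 1]`. -/
def strip : Set (ℝ × ℝ) := {v | v.2 ∈ Icc (-1 : ℝ) 1}

/-- The pullback `Π_σ(ω) = Λ_σ⁻¹(ω) ∩ (ℝ × I^V)`. -/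
def pullback (a b : ℝ) (σ : ℤˣ) (ω : Set (ℝ × ℝ)) : Set (ℝ × ℝ) :=
  branch a b σ ⁻¹' ω ∩ strip

/-- `β_m` for `m ≥ 1`: `β_1 = W_0^S(z_+) ∩ (ℝ × I^V)` and `β_m = Π_-(β_{m-1})` for `m ≥ 2`. -/
def beta (a b : ℝ) (m : ℕ) : Set (ℝ × ℝ) :=
  (pullback a b (-1))^[m - 1] (stableSegment a b 1 ∩ strip)

/-- `γ_m = Π_+(β_m)` for `m ≥ 1`. -/
def gamma (a b : ℝ) (m : ℕ) : Set (ℝ × ℝ) := pullback a b 1 (beta a b m)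

/-- The vertical segment `{(c + s y, y) : y ∈ I^V}`. -/
def vseg (c s : ℝ) : Set (ℝ × ℝ) := {v | v ∈ strip ∧ v.1 = c + s * v.2}

/-- The vertical strip `V(α, β)`: the region of `ℝ × I^V` between two vertical segments,
including the segments. -/
def vstrip (α β : Set (ℝ × ℝ)) : Set (ℝ × ℝ) :=
  {v | v ∈ strip ∧ ∃ x₁ x₂ : ℝ, (x₁, v.2) ∈ α ∧ (x₂, v.2) ∈ β ∧ v.1 ∈ uIcc x₁ x₂}

/-- `C_m = V(γ_{m-1}, γ_m)` for `m ≥ 2`. -/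
def setC (a b : ℝ) (m : ℕ) : Set (ℝ × ℝ) := vstrip (gamma a b (m - 1)) (gamma a b m)

/-- `U_m = Λ^m(C_m)`. -/
def setU (a b : ℝ) (m : ℕ) : Set (ℝ × ℝ) := (lozi a b)^[m] '' setC a b m

/-- `C_{m,n} = Λ^{-m}(U_m ∩ C_n)`, the preimage being taken for `Λ^m : C_m → U_m`. -/
def setCC (a b : ℝ) (m n : ℕ) : Set (ℝ × ℝ) :=
  setC a b m ∩ (lozi a b)^[m] ⁻¹' (setU a b m ∩ setC a b n)

/-- `C_{m,n}` is the union of two disjoint vertical strips, `L` on the left and `R` on the right,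
which are bounded by vertical segments contained in `W^S(z_+)`. -/
def IsSplitting (a b : ℝ) (m n : ℕ) (L R : Set (ℝ × ℝ)) : Prop :=
  ∃ c s : Fin 4 → ℝ,
    (∀ i, vseg (c i) (s i) ⊆ stableSet a b (fixedPoint a b 1)) ∧
    (∀ y ∈ Icc (-1 : ℝ) 1, StrictMono fun i => c i + s i * y) ∧
    L = vstrip (vseg (c 0) (s 0)) (vseg (c 1) (s 1)) ∧
    R = vstrip (vseg (c 2) (s 2)) (vseg (c 3) (s 3)) ∧
    setCC a b m n = L ∪ R

/-- The left component `C_{m,n}^L` of `C_{m,n}`. The splitting is unique if it exists; the set is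
empty if `C_{m,n}` does not split. -/
def leftComponent (a b : ℝ) (m n : ℕ) : Set (ℝ × ℝ) :=
  {v | ∃ L R : Set (ℝ × ℝ), IsSplitting a b m n L R ∧ v ∈ L}

end Lozi

end

/-! A formal orbit is encoded by the scalar sequence z of its coordinates, its k-th point being
(z_{k+1}, z_k). A symbol enters only as a sign in a linear recursion, and formal periodic points are
cyclic solutions of it. Since a > b + 1, the term s_k a z_{k+1} dominates, and a maximum principle
(`mul_abs_le_of_cyclic`) gives existence and uniqueness of cyclic solutions, the bound |z_k| ≤ 1,
and bounds on their derivatives in the parameters.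

The last symbol σ is tested by the critical coordinate z_0 = z_{m+n}. Near (a, b) = (2, 0) the long
block of left symbols, read backwards, contracts towards -1. Hence z_2 is close to -1, z_1 is close
to 1, and a²σz_0 is close to a(a - 2). There all other admissibility conditions hold strictly
(`IsIotaSolution.pos_of_nearTent`), while σz_0 increases strictly with a
(`IsVariation.critical_pos`), so the curve l is the unique zero of z_0. For larger a the bound |z_k|
≤ 1 already forces every sign (`IsIotaSolution.pos_of_large`). For smaller a an admissible orbit
would be pushed across x = 0 inside the left block (`IsIotaSolution.not_admissible`). The cyclic
solution is rational in (a, b) by Cramer's formula, so l is analytic by the implicit function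
theorem.

Differentiating z_0 = 0 along the curve shows that the slope of l is close to z_{m+n-1}, the
coordinate just before the critical one. This is near 1/2 for n = 2 and near -1/2 for n = 3, so the
slopes have opposite signs.

For the strips, nearly vertical lines are pulled back by the affine branches; Λ_- preserves left and
right and Λ_+ reverses them. The first m - 1 steps on C_m are affine, and only the last one folds,
so C_n has two preimages, separated by x = 0 (`setCC_eq`). The m-th symbol + selects the right one,
which becomes the left component because the earlier steps reverse orientation once
(`mem_leftComponent`). -/

namespace Lozi

/-! ## Coordinate sequences of formal orbits -/

/-- The numerical sign of the `k`-th symbol of a word (`+1` beyond its end). -/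
noncomputable def wordSign (I : List ℤˣ) (k : ℕ) : ℝ := ((I.getD k 1 : ℤˣ) : ℤ)

/-- The scalar sequence `θ.2, θ.1, π₁(Λ_{s₀} θ), …` of a formal orbit with signs `s`. -/
noncomputable def coordSeq (a b : ℝ) (s : ℕ → ℝ) (θ : ℝ × ℝ) : ℕ → ℝ
  | 0 => θ.2
  | 1 => θ.1
  | k + 2 => -(s k) * a * coordSeq a b s θ (k + 1) - b * coordSeq a b s θ k + (a - b - 1)

lemma wordSign_eq_one_or (I : List ℤˣ) (k : ℕ) : wordSign I k = 1 ∨ wordSign I k = -1 := by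
  unfold wordSign
  rcases Int.units_eq_one_or (I.getD k 1) with h | h <;> rw [h] <;> simp

lemma wordSign_of_lt (I : List ℤˣ) {k : ℕ} (hk : k < I.length) :
    wordSign I k = ((I[k] : ℤ) : ℝ) := by
  simp [wordSign, hk]

lemma formalMap_take_succ (a b : ℝ) (I : List ℤˣ) (θ : ℝ × ℝ) {k : ℕ} (hk : k < I.length) :
    formalMap a b (I.take (k + 1)) θ = branch a b I[k] (formalMap a b (I.take k) θ) := by
  unfold formalMap
  rw [← List.take_concat_get' I k hk, List.foldl_append]
  rfl

lemma formalMap_take_eq_coordSeq (a b : ℝ) (I : List ℤˣ) (θ : ℝ × ℝ) {k : ℕ}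
    (hk : k ≤ I.length) :
    formalMap a b (I.take k) θ =
      (coordSeq a b (wordSign I) θ (k + 1), coordSeq a b (wordSign I) θ k) := by
  induction k with
  | zero => rfl
  | succ k ih =>
    rw [formalMap_take_succ a b I θ hk, ih (by omega)]
    simp only [branch, coordSeq, wordSign_of_lt I hk]

lemma isFormalPeriodic_iff (a b : ℝ) (I : List ℤˣ) (θ : ℝ × ℝ) :
    IsFormalPeriodic a b I θ ↔
      coordSeq a b (wordSign I) θ I.length = coordSeq a b (wordSign I) θ 0 ∧
      coordSeq a b (wordSign I) θ (I.length + 1) = coordSeq a b (wordSign I) θ 1 := by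
  have h := formalMap_take_eq_coordSeq a b I θ le_rfl
  rw [List.take_length] at h
  rw [IsFormalPeriodic, h, Prod.ext_iff, and_comm]
  rfl

lemma admissible_iff (a b : ℝ) (I : List ℤˣ) (θ : ℝ × ℝ) :
    Admissible a b I θ ↔
      ∀ k < I.length, 0 ≤ wordSign I k * coordSeq a b (wordSign I) θ (k + 1) := by
  refine forall₂_congr fun k hk => ?_
  rw [formalMap_take_eq_coordSeq a b I θ hk.le, wordSign_of_lt I hk]

lemma lozi_eq_branch (a b : ℝ) {σ : ℤˣ} {v : ℝ × ℝ} (h : 0 ≤ ((σ : ℤ) : ℝ) * v.1) :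
    lozi a b v = branch a b σ v := by
  rcases Int.units_eq_one_or σ with rfl | rfl
  · have : 0 ≤ v.1 := by simpa using h
    simp [lozi, branch, abs_of_nonneg this]
  · have : v.1 ≤ 0 := by simpa using h
    simp [lozi, branch, abs_of_nonpos this]

lemma lozi_iterate_eq_coordSeq {a b : ℝ} {I : List ℤˣ} {θ : ℝ × ℝ} (h : Admissible a b I θ)
    {k : ℕ} (hk : k ≤ I.length) :
    (lozi a b)^[k] θ =
      (coordSeq a b (wordSign I) θ (k + 1), coordSeq a b (wordSign I) θ k) := by
  rw [← formalMap_take_eq_coordSeq a b I θ hk]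
  induction k with
  | zero => rfl
  | succ k ih =>
    rw [Function.iterate_succ_apply', ih (by omega), formalMap_take_succ a b I θ hk]
    exact lozi_eq_branch a b (h k hk)

/-- The maximum principle for a perturbed cyclic recursion `s a z' + z'' + b z = O(Q)`. -/
lemma mul_abs_le_of_cyclic {a b Q : ℝ} {s z : ℕ → ℝ} {N : ℕ} (hN : 0 < N) (hb : 0 ≤ b)
    (ha : 0 ≤ a) (hs : ∀ k, s k = 1 ∨ s k = -1)
    (hz : ∀ k < N, |s k * a * z (k + 1) + z (k + 2) + b * z k| ≤ Q)
    (h0 : z N = z 0) (h1 : z (N + 1) = z 1) {k : ℕ} (hk : k ≤ N + 1) (hab : b + 1 ≤ a) :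
    (a - b - 1) * |z k| ≤ Q := by
  -- The recursion is evaluated at the index where the middle term is largest; periodicity extends
  -- the maximum from the indices 1, …, N to 0 and N + 1.
  obtain ⟨i, hi, hmax⟩ := Finset.exists_max_image (Finset.range N) (fun i => |z (i + 1)|)
    ⟨0, by simpa using hN⟩
  have hi' : i < N := by simpa using hi
  have hmid : ∀ j, j < N → |z (j + 1)| ≤ |z (i + 1)| := fun j hj => hmax j (by simpa using hj)
  have hall : ∀ j, j ≤ N + 1 → |z j| ≤ |z (i + 1)| := by
    intro j hj
    rcases Nat.eq_zero_or_pos j with rfl | hpos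
    · rw [← h0]
      obtain ⟨p, rfl⟩ : ∃ p, N = p + 1 := ⟨N - 1, by omega⟩
      exact hmid p (by omega)
    · obtain ⟨p, rfl⟩ : ∃ p, j = p + 1 := ⟨j - 1, by omega⟩
      rcases Nat.lt_or_ge p N with hp | hp
      · exact hmid p hp
      · obtain rfl : p = N := by omega
        rw [h1]
        exact hmid 0 hN
  have e1 : a * |z (i + 1)| = |s i * a * z (i + 1)| := by
    rw [abs_mul, abs_mul, abs_of_nonneg ha]
    rcases hs i with h | h <;> simp [h]
  have e2 : |s i * a * z (i + 1)| ≤ Q + |z (i + 2)| + b * |z i| := by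
    have h := hz i hi'
    have hb' : b * |z i| = |b * z i| := by rw [abs_mul, abs_of_nonneg hb]
    rw [hb']
    calc |s i * a * z (i + 1)|
        = |(s i * a * z (i + 1) + z (i + 2) + b * z i) - z (i + 2) - b * z i| := by
          congr 1; ring
      _ ≤ _ := (abs_sub _ _).trans (by
          linarith [abs_sub (s i * a * z (i + 1) + z (i + 2) + b * z i) (z (i + 2))])
  have e3 := hall (i + 2) (by omega)
  have e4 := mul_le_mul_of_nonneg_left (hall i (by omega)) hb
  have e5 := mul_le_mul_of_nonneg_left (hall k hk) (by linarith : 0 ≤ a - b - 1)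
  linarith

/-- A cyclic solution of the recursion of the Lozi family with prescribed signs. -/
structure IsCyclicSolution (a b : ℝ) (s : ℕ → ℝ) (N : ℕ) (z : ℕ → ℝ) : Prop where
  rec_eq : ∀ k, z (k + 2) = -(s k) * a * z (k + 1) - b * z k + (a - b - 1)
  per_zero : z N = z 0
  per_one : z (N + 1) = z 1

lemma coordSeq_isCyclicSolution {a b : ℝ} {I : List ℤˣ} {θ : ℝ × ℝ}
    (h : IsFormalPeriodic a b I θ) :
    IsCyclicSolution a b (wordSign I) I.length (coordSeq a b (wordSign I) θ) :=
  ⟨fun _ => rfl, ((isFormalPeriodic_iff a b I θ).1 h).1, ((isFormalPeriodic_iff a b I θ).1 h).2⟩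

/-- The constant term a - b - 1 of the recursion equals the factor gained in the maximum principle,
so the two cancel. -/
lemma IsCyclicSolution.abs_le_one {a b : ℝ} {s z : ℕ → ℝ} {N : ℕ}
    (h : IsCyclicSolution a b s N z) (hN : 0 < N) (hb : 0 ≤ b) (hab : b + 1 < a)
    (hs : ∀ k, s k = 1 ∨ s k = -1) {k : ℕ} (hk : k ≤ N + 1) : |z k| ≤ 1 := by
  have := mul_abs_le_of_cyclic (Q := a - b - 1) hN hb (by linarith) hs (z := z) (fun k _ => ?_)
    h.per_zero h.per_one hk hab.le
  · nlinarith
  · rw [h.rec_eq k]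
    refine le_of_eq (Eq.trans (congrArg _ ?_) (abs_of_nonneg (show 0 ≤ a - b - 1 by linarith)))
    ring

lemma length_iota (σ : ℤˣ) {m n : ℕ} (hm : 2 ≤ m) (hn : 2 ≤ n) : (iota σ m n).length = m + n := by
  simp [iota, iotaStem]; omega

lemma length_iotaStem {m n : ℕ} (hm : 2 ≤ m) (hn : 2 ≤ n) :
    (iotaStem m n).length = m + n - 1 := by
  simp [iotaStem]; omega

/-- The sign pattern of `ι_{σ,m,n}`. -/
structure IotaSigns (s : ℕ → ℝ) (m n : ℕ) (σ : ℝ) : Prop where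
  first : s 0 = 1
  left : ∀ k, k + 3 ≤ m → s (k + 1) = -1
  mid_zero : s (m - 1) = 1
  mid_one : s m = 1
  right : ∀ k, m + 1 ≤ k → k + 2 ≤ m + n → s k = -1
  last : s (m + n - 1) = σ

lemma iotaSigns_wordSign (σ : ℤˣ) {m n : ℕ} (hm : 2 ≤ m) (hn : 2 ≤ n) :
    IotaSigns (wordSign (iota σ m n)) m n ((σ : ℤ) : ℝ) := by
  have key : ∀ k, wordSign (iota σ m n) k = if k = 0 then 1 else if k + 2 ≤ m then -1 else
      if k ≤ m then 1 else if k + 2 ≤ m + n then -1 else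
      if k + 1 = m + n then ((σ : ℤ) : ℝ) else 1 := by
    intro k
    unfold wordSign iota iotaStem
    simp only [List.getD_eq_getElem?_getD, List.getElem?_append, List.length_append,
      List.length_replicate, List.length_cons, List.length_nil, List.getElem?_replicate,
      List.getElem?_cons]
    split_ifs <;> first | omega | simp
  constructor
  · simp [key]
  · intro k hk; simp [key]; omega
  · rw [key]; split_ifs <;> first | omega | rfl
  · rw [key]; split_ifs <;> first | omega | rfl
  · intro k h1 h2; rw [key]; split_ifs <;> first | omega | rfl
  · rw [key]; split_ifs <;> first | omega | rfl

/-! ## Estimates near the full tent map -/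

/-- Expansion read backwards contracts: each step back costs a factor at most 2/3, and the errors
add up to at most c(2/3 + (2/3)² + ⋯) = 2c. -/
lemma abs_le_of_expanding {a B c : ℝ} {w : ℕ → ℝ} (ha : 3 / 2 ≤ a) (hc : 0 ≤ c) (j k : ℕ)
    (hw : ∀ i, k ≤ i → i < k + j → a * |w i| ≤ |w (i + 1)| + c) (hB : |w (k + j)| ≤ B) :
    |w k| ≤ 2 * c + B * (2 / 3) ^ j := by
  induction j generalizing k with
  | zero => simp at hB ⊢; linarith
  | succ j ih =>
    have h1 := ih (k + 1) (fun i h1 h2 => hw i (by omega) (by omega))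
      (by rwa [show k + 1 + j = k + (j + 1) by ring])
    have h2 := hw k le_rfl (by omega)
    have h3 : 3 / 2 * |w k| ≤ a * |w k| := mul_le_mul_of_nonneg_right ha (abs_nonneg _)
    rw [pow_succ]
    linarith

/-- Parameters in a small box around the full tent map, with a long itinerary. -/
structure NearTent (a b : ℝ) (m : ℕ) : Prop where
  a_ge : 99 / 50 ≤ a
  a_le : a ≤ 101 / 50
  b_nonneg : 0 ≤ b
  b_le : b ≤ 1 / 10000
  m_ge : 60 ≤ m

/-- A cyclic solution for the sign pattern of `ι_{σ,m,n}`. -/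
structure IsIotaSolution (a b : ℝ) (m n : ℕ) (σ : ℝ) (s z : ℕ → ℝ) : Prop where
  cyclic : IsCyclicSolution a b s (m + n) z
  signs : IotaSigns s m n σ
  sign_eq : ∀ k, s k = 1 ∨ s k = -1
  n_eq : n = 2 ∨ n = 3

section

variable {a b σ : ℝ} {m n : ℕ} {s z : ℕ → ℝ}

lemma IsIotaSolution.sigma_eq (h : IsIotaSolution a b m n σ s z) : σ = 1 ∨ σ = -1 := by
  rw [← h.signs.last]; exact h.sign_eq _

lemma IsIotaSolution.abs_le_one (h : IsIotaSolution a b m n σ s z) (hb : 0 ≤ b) (hab : b + 1 < a)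
    {k : ℕ} (hk : k ≤ m + n + 1) : |z k| ≤ 1 :=
  h.cyclic.abs_le_one (by have := h.n_eq; omega) hb hab h.sign_eq hk

/-- In the coordinate 1 + z, centred at the fixed point z_- = (-1, -1), the left branch is linear
without constant term. -/
lemma IsIotaSolution.rec_left (h : IsIotaSolution a b m n σ s z) {k : ℕ} (hk : k + 3 ≤ m) :
    a * (1 + z (k + 2)) = (1 + z (k + 3)) + b * (1 + z (k + 1)) := by
  have := h.cyclic.rec_eq (k + 1)
  rw [h.signs.left k hk] at this
  linear_combination -this

lemma IsIotaSolution.rec_first (h : IsIotaSolution a b m n σ s z) :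
    z 2 = -a * z 1 - b * z 0 + (a - b - 1) := by
  have := h.cyclic.rec_eq 0
  rw [h.signs.first] at this
  simpa using this

lemma IsIotaSolution.rec_last (h : IsIotaSolution a b m n σ s z) :
    z 1 = -σ * a * z 0 - b * z (m + n - 1) + (a - b - 1) := by
  have h2 := h.n_eq
  have := h.cyclic.rec_eq (m + n - 1)
  rwa [h.signs.last, show m + n - 1 + 2 = m + n + 1 by omega,
    show m + n - 1 + 1 = m + n by omega, h.cyclic.per_zero, h.cyclic.per_one] at this

/-- For `a > 2 + 2b` every formal point is hyperbolic. -/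
lemma IsIotaSolution.pos_of_large (h : IsIotaSolution a b m n σ s z) (hb : 0 ≤ b)
    (ha : 2 + 2 * b < a) {k : ℕ} (hk : k < m + n) : 0 < s k * z (k + 1) := by
  have h1 := abs_le.1 (h.abs_le_one hb (by linarith) (show k + 2 ≤ m + n + 1 by omega))
  have h2 := abs_le.1 (h.abs_le_one hb (by linarith) (show k ≤ m + n + 1 by omega))
  have h3 := h.cyclic.rec_eq k
  -- The recursion gives a s_k z_{k+1} = a - b - 1 - z_{k+2} - b z_k ≥ a - 2 - 2b.
  have h4 : 0 < a * (s k * z (k + 1)) := by nlinarith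
  exact (mul_pos_iff_of_pos_left (by linarith)).1 h4

lemma IsIotaSolution.abs_le_one' (h : IsIotaSolution a b m n σ s z) (hp : NearTent a b m)
    {k : ℕ} (hk : k ≤ m + n + 1) : |z k| ≤ 1 :=
  h.abs_le_one hp.b_nonneg (by linarith [hp.a_ge, hp.b_le]) hk

lemma IsIotaSolution.b_mul_le (h : IsIotaSolution a b m n σ s z) (hp : NearTent a b m)
    {k : ℕ} (hk : k ≤ m + n + 1) : -(1 / 10000) ≤ b * z k ∧ b * z k ≤ 1 / 10000 := by
  have h1 := abs_le.1 (h.abs_le_one' hp hk)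
  have h2 := hp.b_nonneg
  have h3 := hp.b_le
  constructor <;> nlinarith

/-- The left block is followed backwards from time m. As k ≤ 29 and m ≥ 60, at least 29 contracting
steps are available, and what remains is essentially the error 4b. -/
lemma IsIotaSolution.one_add_le (h : IsIotaSolution a b m n σ s z) (hp : NearTent a b m)
    {k : ℕ} (hk : k ≤ 29) : 0 ≤ 1 + z (k + 2) ∧ 1 + z (k + 2) ≤ 1 / 2000 := by
  have hm := hp.m_ge
  have hpos : ∀ i, i ≤ m + n + 1 → 0 ≤ 1 + z i ∧ 1 + z i ≤ 2 := fun i hi => by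
    have := abs_le.1 (h.abs_le_one' hp hi)
    constructor <;> linarith
  have hlast := hpos m (by omega)
  have := abs_le_of_expanding (a := a) (B := 2) (c := 2 * b) (w := fun i => 1 + z (i + 2))
    (by linarith [hp.a_ge]) (by linarith [hp.b_nonneg]) (m - 2 - k) k (fun i h1 h2 => by
      have e := h.rec_left (k := i) (by omega)
      have p1 := hpos (i + 1) (by omega)
      rw [abs_of_nonneg (hpos (i + 2) (by omega)).1, abs_of_nonneg (hpos (i + 3) (by omega)).1, e]
      nlinarith [hp.b_nonneg]) (by
      simp only [show k + (m - 2 - k) + 2 = m by omega]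
      rw [abs_of_nonneg hlast.1]; exact hlast.2)
  have hpw : ((2 : ℝ) / 3) ^ (m - 2 - k) ≤ (2 / 3) ^ 29 :=
    pow_le_pow_of_le_one (by norm_num) (by norm_num) (by omega)
  have hnum : ((2 : ℝ) / 3) ^ 29 ≤ 1 / 100000 := by norm_num
  have h0 := hpos (k + 2) (by omega)
  rw [abs_of_nonneg h0.1] at this
  exact ⟨h0.1, by linarith [hp.b_le]⟩

lemma IsIotaSolution.first_bounds (h : IsIotaSolution a b m n σ s z) (hp : NearTent a b m) :
    1 - 1 / 2500 ≤ z 1 ∧ z 1 ≤ 1 := by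
  have h1 := h.one_add_le hp (k := 0) (by norm_num)
  have h2 := h.b_mul_le hp (k := 0) (by omega)
  have h3 := h.rec_first
  have h4 := hp.b_le
  have h5 := hp.a_ge
  exact ⟨by nlinarith, (abs_le.1 (h.abs_le_one' hp (k := 1) (by omega))).2⟩

/-- Eliminating z_1 between the first and the last relation leaves only 1 + z_2 and multiples of b
as error. -/
lemma IsIotaSolution.critical_estimate (h : IsIotaSolution a b m n σ s z)
    (hp : NearTent a b m) : |a ^ 2 * (σ * z 0) - a * (a - 2)| ≤ 1 / 500 := by
  have h1 := h.one_add_le hp (k := 0) (by norm_num)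
  have h2 := h.b_mul_le hp (k := 0) (by omega)
  have h2' := h.b_mul_le hp (k := m + n - 1) (by omega)
  have h3 := h.rec_first
  have h3' := h.rec_last
  have h4 := hp.b_le
  have h4' := hp.b_nonneg
  have h5 := hp.a_ge
  have h5' := hp.a_le
  have key : a ^ 2 * (σ * z 0) - a * (a - 2) =
      (1 + z 2) + b + b * z 0 - a * b - a * (b * z (m + n - 1)) := by
    simp only [zero_add] at *
    linear_combination a * h3' - h3
  rw [key, abs_le]
  simp only [zero_add] at *
  constructor <;> nlinarith

lemma IsIotaSolution.critical_small (h : IsIotaSolution a b m n σ s z)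
    (hp : NearTent a b m) : |z 0| ≤ 1 / 50 := by
  have h1 := abs_le.1 (h.critical_estimate hp)
  have h5 := hp.a_ge
  have h5' := hp.a_le
  have h6 : |σ * z 0| ≤ 1 / 50 := by
    rw [abs_le]; constructor <;> nlinarith
  rcases h.sigma_eq with rfl | rfl <;> simpa using h6

/-- The tail is solved backwards from z_{m+n} = z_0, which is nearly 0. In the model a = 2, b = 0,
z_0 = 0 the values are z_{m+1} = 1/2, z_m = 1/4 for n = 2, and z_{m+2} = -1/2, z_{m+1} = 3/4, z_m =
1/8 for n = 3. -/
lemma IsIotaSolution.mid_bounds (h : IsIotaSolution a b m n σ s z) (hp : NearTent a b m) :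
    (0 < z m ∧ z m ≤ 3 / 10) ∧ 0 < z (m + 1) ∧
      (n = 2 → 23 / 50 ≤ z (m + 1)) ∧ (n = 3 → z (m + 2) ≤ -(23 / 50)) := by
  have hX := abs_le.1 (h.critical_small hp)
  have hm := hp.m_ge
  have h4 := hp.b_le
  have h4' := hp.b_nonneg
  have h5 := hp.a_ge
  have h5' := hp.a_le
  have e1 := h.cyclic.rec_eq (m - 1)
  rw [h.signs.mid_zero, show m - 1 + 2 = m + 1 by omega, show m - 1 + 1 = m by omega] at e1
  have e2 := h.cyclic.rec_eq m
  rw [h.signs.mid_one] at e2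
  have b1 := h.b_mul_le hp (k := m - 1) (by omega)
  have b2 := h.b_mul_le hp (k := m) (by omega)
  rcases h.n_eq with rfl | rfl
  · rw [h.cyclic.per_zero] at e2
    have l1 : 23 / 50 ≤ z (m + 1) := by nlinarith
    have l2 : z (m + 1) ≤ 53 / 100 := by nlinarith
    exact ⟨⟨by nlinarith, by nlinarith⟩, by linarith, fun _ => l1, by omega⟩
  · have e3 := h.cyclic.rec_eq (m + 1)
    rw [h.signs.right (m + 1) le_rfl (by omega), show m + 1 + 2 = m + 3 by omega,
      h.cyclic.per_zero, show m + 1 + 1 = m + 2 by omega] at e3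
    have b3 := h.b_mul_le hp (k := m + 1) (by omega)
    have l1 : z (m + 2) ≤ -(23 / 50) := by nlinarith
    have l2 : -(53 / 100) ≤ z (m + 2) := by nlinarith
    have l3 : z (m + 1) ≤ 79 / 100 := by nlinarith
    have l4 : 7 / 10 ≤ z (m + 1) := by nlinarith
    exact ⟨⟨by nlinarith, by nlinarith⟩, by linarith, by omega, fun _ => l1⟩

/-- Backward induction from z_m ≤ 3/10: one step back roughly halves the distance to -1, so a value
at most 3/10 comes from one at most -3/10. Here j counts the distance to the end of the block. -/
lemma IsIotaSolution.left_neg (h : IsIotaSolution a b m n σ s z) (hp : NearTent a b m)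
    (j k : ℕ) (hk : k + j + 3 = m) : z (k + 2) ≤ -(3 / 10) := by
  have h4 := hp.b_le
  have h4' := hp.b_nonneg
  have h5 := hp.a_ge
  have b1 := h.b_mul_le hp (k := k + 1) (by omega)
  have e := h.rec_left (k := k) (by omega)
  induction j generalizing k with
  | zero =>
    have hmid := (h.mid_bounds hp).1.2
    rw [show k + 3 = m by omega] at e
    nlinarith
  | succ j ih =>
    have := ih (k + 1) (by omega) (h.b_mul_le hp (by omega)) (h.rec_left (by omega))
    rw [show k + 1 + 2 = k + 3 by omega] at this
    nlinarith

/-- Near the tent family only the last symbol of the itinerary can fail. -/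
lemma IsIotaSolution.pos_of_nearTent (h : IsIotaSolution a b m n σ s z) (hp : NearTent a b m)
    {k : ℕ} (hk : k + 1 < m + n) : 0 < s k * z (k + 1) := by
  have hm := hp.m_ge
  obtain ⟨h1, h2, h3, h4⟩ := h.mid_bounds hp
  have hn := h.n_eq
  rcases Nat.eq_zero_or_pos k with rfl | hk0
  · rw [h.signs.first]; linarith [(h.first_bounds hp).1]
  by_cases hk1 : k + 2 ≤ m
  · obtain ⟨i, rfl⟩ : ∃ i, k = i + 1 := ⟨k - 1, by omega⟩
    rw [h.signs.left i (by omega)]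
    linarith [h.left_neg hp (m - 3 - i) i (by omega)]
  by_cases hk2 : k = m - 1
  · subst hk2
    rw [h.signs.mid_zero, show m - 1 + 1 = m by omega]; linarith
  by_cases hk3 : k = m
  · subst hk3
    rw [h.signs.mid_one]; linarith
  · obtain rfl : n = 3 := by omega
    obtain rfl : k = m + 1 := by omega
    rw [h.signs.right (m + 1) le_rfl (by omega)]
    linarith [h4 rfl]

end

/-! ## Variation of cyclic solutions and non-admissibility -/

/-- The recursion obtained by differentiating a cyclic solution `z` along a path of parameters
with velocity `(p, q)`. -/
structure IsVariation (a b p q : ℝ) (s z : ℕ → ℝ) (N : ℕ) (w : ℕ → ℝ) : Prop where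
  rec_eq : ∀ k, w (k + 2) =
    -(s k) * a * w (k + 1) - b * w k + p * (1 - s k * z (k + 1)) - q * (1 + z k)
  per_zero : w N = w 0
  per_one : w (N + 1) = w 1

section

variable {a b p q σ : ℝ} {m n : ℕ} {s z w : ℕ → ℝ}

/-- As |z_k| ≤ 1, the forcing is at most 2(|p| + |q|), and 2/(a - b - 1) ≤ 21/10. -/
lemma IsVariation.abs_le (hw : IsVariation a b p q s z (m + n) w)
    (h : IsIotaSolution a b m n σ s z) (hp : NearTent a b m) {k : ℕ} (hk : k ≤ m + n + 1) :
    |w k| ≤ 21 / 10 * (|p| + |q|) := by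
  have h4 := hp.b_le
  have h5 := hp.a_ge
  have := mul_abs_le_of_cyclic (Q := 2 * |p| + 2 * |q|) (N := m + n) (by have := h.n_eq; omega)
    hp.b_nonneg (by linarith) h.sign_eq (z := w) (fun k hk => ?_) hw.per_zero hw.per_one hk
    (by linarith)
  · nlinarith [abs_nonneg (w k), abs_nonneg p, abs_nonneg q]
  · have h1 := _root_.abs_le.1 (h.abs_le_one' hp (show k + 1 ≤ m + n + 1 by omega))
    have h2 := _root_.abs_le.1 (h.abs_le_one' hp (show k ≤ m + n + 1 by omega))
    rw [hw.rec_eq k, show s k * a * w (k + 1) + (-s k * a * w (k + 1) - b * w k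
      + p * (1 - s k * z (k + 1)) - q * (1 + z k)) + b * w k
      = p * (1 - s k * z (k + 1)) - q * (1 + z k) by ring]
    refine (abs_sub _ _).trans ?_
    rw [abs_mul, abs_mul, mul_comm (2 : ℝ), mul_comm (2 : ℝ)]
    have h3 : |1 - s k * z (k + 1)| ≤ 2 := by
      rw [_root_.abs_le]
      rcases h.sign_eq k with e | e <;> rw [e] <;> constructor <;> linarith
    have h4 : |1 + z k| ≤ 2 := by rw [_root_.abs_le]; constructor <;> linarith
    gcongr

lemma IsVariation.rec_left (hw : IsVariation a b p q s z (m + n) w)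
    (h : IsIotaSolution a b m n σ s z) {k : ℕ} (hk : k + 3 ≤ m) :
    a * w (k + 2) = w (k + 3) + b * w (k + 1) - p * (1 + z (k + 2)) + q * (1 + z (k + 1)) := by
  have := hw.rec_eq (k + 1)
  rw [h.signs.left k hk] at this
  linear_combination -this

lemma IsVariation.b_mul_le (hw : IsVariation a b p q s z (m + n) w)
    (h : IsIotaSolution a b m n σ s z) (hp : NearTent a b m) {k : ℕ} (hk : k ≤ m + n + 1) :
    |b * w k| ≤ 21 / 100000 * (|p| + |q|) := by
  have h1 := hw.abs_le h hp hk
  rw [abs_mul, abs_of_nonneg hp.b_nonneg]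
  nlinarith [hp.b_le, hp.b_nonneg, abs_nonneg (w k)]

/-- The backward contraction also applies to the derivatives, because the forcing in the left block
carries the small factors 1 + z. It stops at w_3: the forcing of w_2 contains q(1 + z_1), which is
about 2q. -/
lemma IsVariation.left_small (hw : IsVariation a b p q s z (m + n) w)
    (h : IsIotaSolution a b m n σ s z) (hp : NearTent a b m) :
    |w 3| ≤ 1 / 500 * (|p| + |q|) := by
  have hm := hp.m_ge
  have h5 := hp.a_ge
  have hE : 0 ≤ |p| + |q| := by positivity
  -- The error 71/100000 is 21/100000 from b w plus 1/2000 from the factors 1 + z.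
  have := abs_le_of_expanding (a := a) (B := 21 / 10 * (|p| + |q|))
    (c := 71 / 100000 * (|p| + |q|)) (w := fun i => w (i + 2))
    (by linarith) (by linarith) 24 1 (fun i h1 h2 => by
      have e := hw.rec_left h (k := i) (by omega)
      have u1 := h.one_add_le hp (k := i) (by omega)
      obtain ⟨i, rfl⟩ : ∃ i', i = i' + 1 := ⟨i - 1, by omega⟩
      have u0 := h.one_add_le hp (k := i) (by omega)
      have hb := hw.b_mul_le h hp (k := i + 1 + 1) (by omega)
      have e1 : a * |w (i + 1 + 2)| = |a * w (i + 1 + 2)| := by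
        rw [abs_mul, abs_of_nonneg (show 0 ≤ a by linarith)]
      have e2 : |p * (1 + z (i + 1 + 2))| ≤ 1 / 2000 * |p| := by
        rw [abs_mul, abs_of_nonneg u1.1]; nlinarith [abs_nonneg p]
      have e3 : |q * (1 + z (i + 1 + 1))| ≤ 1 / 2000 * |q| := by
        rw [abs_mul, abs_of_nonneg u0.1]; nlinarith [abs_nonneg q]
      rw [e1, e]
      rw [_root_.abs_le] at *
      obtain ⟨l1, l2⟩ := _root_.abs_le.1 (le_refl |w (i + 1 + 3)|)
      constructor <;> linarith) (hw.abs_le h hp (by omega))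
  have hnum : ((2 : ℝ) / 3) ^ 24 ≤ 1 / 10000 := by norm_num
  calc |w 3| ≤ _ := this
    _ ≤ 2 * (71 / 100000 * (|p| + |q|)) + 21 / 10 * (|p| + |q|) * (1 / 10000) := by gcongr
    _ ≤ _ := by linarith

lemma IsVariation.rec_first (hw : IsVariation a b p q s z (m + n) w)
    (h : IsIotaSolution a b m n σ s z) :
    w 2 = -a * w 1 - b * w 0 + p * (1 - z 1) - q * (1 + z 0) := by
  have := hw.rec_eq 0
  rw [h.signs.first] at this
  simpa using this

lemma IsVariation.rec_last (hw : IsVariation a b p q s z (m + n) w)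
    (h : IsIotaSolution a b m n σ s z) :
    w 1 = -σ * a * w 0 - b * w (m + n - 1) + p * (1 - σ * z 0) - q * (1 + z (m + n - 1)) := by
  have h2 := h.n_eq
  have := hw.rec_eq (m + n - 1)
  rwa [h.signs.last, show m + n - 1 + 2 = m + n + 1 by omega,
    show m + n - 1 + 1 = m + n by omega, hw.per_zero, hw.per_one, h.cyclic.per_zero] at this

/-- The signed critical coordinate increases with `a`. -/
lemma IsVariation.critical_pos (hw : IsVariation a b 1 0 s z (m + n) w)
    (h : IsIotaSolution a b m n σ s z) (hp : NearTent a b m) : 0 < σ * w 0 := by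
  have hm := hp.m_ge
  have h5 := hp.a_ge
  have h5' := hp.a_le
  have b0 := _root_.abs_le.1 (hw.b_mul_le h hp (k := 0) (by omega))
  have b1 := _root_.abs_le.1 (hw.b_mul_le h hp (k := 1) (by omega))
  have b2 := _root_.abs_le.1 (hw.b_mul_le h hp (k := m + n - 1) (by omega))
  have w3 := _root_.abs_le.1 (hw.left_small h hp)
  have u := h.one_add_le hp (k := 0) (by omega)
  have x := h.first_bounds hp
  have e1 := hw.rec_left h (k := 0) (by omega)
  have e0 := hw.rec_first h
  have e2 := hw.rec_last h
  have X := _root_.abs_le.1 (h.critical_small hp)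
  have X' : σ * z 0 ≤ 1 / 50 := by
    rcases h.sigma_eq with rfl | rfl <;> linarith
  simp only [abs_one, abs_zero, zero_add, add_zero] at *
  -- With q = 0 the values w_2 and then w_1 are small too, and the last relation leaves aσw_0 close
  -- to 1 - σz_0, hence positive.
  have w2 : w 2 ≤ 1 / 500 ∧ -(1 / 500) ≤ w 2 := by constructor <;> nlinarith
  have w1 : w 1 ≤ 1 / 500 := by nlinarith
  have : 0 < a * (σ * w 0) := by linarith
  exact (mul_pos_iff_of_pos_left (by linarith)).1 this

/-- The slope of a curve along which the critical coordinate vanishes. -/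
lemma IsVariation.slope_estimate (hw : IsVariation a b p 1 s z (m + n) w)
    (h : IsIotaSolution a b m n σ s z) (hp : NearTent a b m) (hz : z 0 = 0) (hw0 : w 0 = 0) :
    |p - z (m + n - 1)| ≤ 1 / 50 + 1 / 500 * |p| := by
  have hm := hp.m_ge
  have h5 := hp.a_ge
  have h5' := hp.a_le
  have b1 := _root_.abs_le.1 (hw.b_mul_le h hp (k := 1) (by omega))
  have b2 := _root_.abs_le.1 (hw.b_mul_le h hp (k := m + n - 1) (by omega))
  have w3 := _root_.abs_le.1 (hw.left_small h hp)
  have u := h.one_add_le hp (k := 0) (by omega)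
  have x := h.first_bounds hp
  have e1 := hw.rec_left h (k := 0) (by omega)
  have e0 := hw.rec_first h
  have e2 := hw.rec_last h
  rw [hz, hw0] at *
  simp only [abs_one, zero_add] at *
  set E := |p| + 1
  have hp0 := abs_nonneg p
  have pu : |p * (1 + z 2)| ≤ 1 / 2000 * |p| := by
    rw [abs_mul, abs_of_nonneg u.1]; nlinarith
  have px : |p * (1 - z 1)| ≤ 1 / 2500 * |p| := by
    rw [abs_mul, abs_of_nonneg (show 0 ≤ 1 - z 1 by linarith)]; nlinarith
  have pu' := _root_.abs_le.1 pu
  have hE : E = |p| + 1 := rfl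
  -- The chain is a w_2 ≈ 1 + z_1 ≈ 2, then a²w_1 ≈ -(a + 2) ≈ -a², so w_1 ≈ -1. The last relation
  -- w_1 ≈ p - 1 - z_{m+n-1} then yields p.
  have f1 : |a * w 2 - 2| ≤ 35 / 10000 * E := by
    rw [_root_.abs_le]; constructor <;> linarith
  have f2 : |a * (a * w 1) + a + 2| ≤ 45 / 10000 * E := by
    have e : a * (a * w 1) + a + 2 = a * (p * (1 - z 1)) - (a * w 2 - 2) := by
      linear_combination a * e0
    have : |a * (p * (1 - z 1))| ≤ 101 / 50 * (1 / 2500 * |p|) := by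
      rw [abs_mul, abs_of_nonneg (show 0 ≤ a by linarith)]
      gcongr
    rw [e]
    refine (abs_sub _ _).trans ?_
    linarith
  have f2' := _root_.abs_le.1 f2
  have f3 : |w 1 + 1| ≤ 16 / 1000 + 12 / 10000 * E := by
    have g : |a ^ 2 * (w 1 + 1)| ≤ 606 / 10000 + 45 / 10000 * E := by
      have q1 : -(606 / 10000) ≤ a ^ 2 - a - 2 := by nlinarith
      have q2 : a ^ 2 - a - 2 ≤ 606 / 10000 := by nlinarith
      rw [_root_.abs_le]; constructor <;> linarith
    have q3 : 392 / 100 ≤ a ^ 2 := by nlinarith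
    rw [abs_mul, abs_of_nonneg (sq_nonneg a)] at g
    have := mul_le_mul_of_nonneg_right q3 (abs_nonneg (w 1 + 1))
    linarith
  have f3' := _root_.abs_le.1 f3
  rw [_root_.abs_le]
  constructor <;> linarith

lemma IsVariation.slope_pos (hw : IsVariation a b p 1 s z (m + 2) w)
    (h : IsIotaSolution a b m 2 σ s z) (hp : NearTent a b m) (hz : z 0 = 0) (hw0 : w 0 = 0) :
    0 < p := by
  have h1 := _root_.abs_le.1 (hw.slope_estimate h hp hz hw0)
  have h2 := (h.mid_bounds hp).2.2.1 rfl
  rw [show m + 2 - 1 = m + 1 by omega] at h1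
  rcases abs_cases p with ⟨e, _⟩ | ⟨e, _⟩ <;> linarith

lemma IsVariation.slope_neg (hw : IsVariation a b p 1 s z (m + 3) w)
    (h : IsIotaSolution a b m 3 σ s z) (hp : NearTent a b m) (hz : z 0 = 0) (hw0 : w 0 = 0) :
    p < 0 := by
  have h1 := _root_.abs_le.1 (hw.slope_estimate h hp hz hw0)
  have h2 := (h.mid_bounds hp).2.2.2 rfl
  rw [show m + 3 - 1 = m + 2 by omega] at h1
  rcases abs_cases p with ⟨e, _⟩ | ⟨e, _⟩ <;> linarith

/-- For small t, 3b < t bounds the loss 2b + b² by t, and Bernoulli's inequality wins. For t > 1/4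
the power exceeds 100 while the other factor is at least 1/50. The exponent 57 is 60 - 3. -/
lemma expanding_factor_gt_one {t b : ℝ} (hb : 0 ≤ b) (hb' : b ≤ 1 / 10000) (ht : 3 * b < t)
    (ht' : t < 49 / 50) (K : ℕ) (hK : 57 ≤ K) :
    1 < (1 + t / 2) ^ K * (1 - t ^ 2 - 2 * b - b ^ 2) := by
  have ht0 : 0 < t := by linarith
  rcases le_or_gt t (1 / 4) with h | h
  · have h1 : 1 + (K : ℝ) * (t / 2) ≤ (1 + t / 2) ^ K :=
      one_add_mul_le_pow (by linarith) K
    have hK' : (57 : ℝ) ≤ K := by exact_mod_cast hK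
    have h2 : 1 + 28 * t ≤ (1 + t / 2) ^ K := by nlinarith
    have h3 : 1 - t ^ 2 - t ≤ 1 - t ^ 2 - 2 * b - b ^ 2 := by nlinarith
    have h4 : 0 < 1 - t ^ 2 - t := by nlinarith
    calc 1 < (1 + 28 * t) * (1 - t ^ 2 - t) := by nlinarith
      _ ≤ _ := by gcongr
  · have h1 : ((9 : ℝ) / 8) ^ 57 ≤ (1 + t / 2) ^ K :=
      (pow_le_pow_left₀ (by norm_num) (by linarith) 57).trans
        (pow_le_pow_right₀ (by linarith) hK)
    have h1' : (100 : ℝ) ≤ (9 / 8) ^ 57 := by norm_num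
    have h3 : (1 : ℝ) / 50 ≤ 1 - t ^ 2 - 2 * b - b ^ 2 := by nlinarith
    nlinarith

/-- Away from the full tent map the itinerary is not realized. -/
lemma IsIotaSolution.not_admissible (h : IsIotaSolution a b m n σ s z) (hm : 60 ≤ m)
    (hb : 0 ≤ b) (hb' : b ≤ 1 / 10000) (hab : 3 * b + 1 < a) (ha : a < 99 / 50)
    (hadm : ∀ k < m + n, 0 ≤ s k * z (k + 1)) : False := by
  have hbd : ∀ i, i ≤ m + n + 1 → 0 ≤ 1 + z i ∧ 1 + z i ≤ 2 := fun i hi => by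
    have := abs_le.1 (h.abs_le_one hb (by linarith) hi)
    constructor <;> linarith
  -- L and M = a - L are the eigenvalues of the linear part of Λ_-; the functional (1 + z_{k+2}) -
  -- M(1 + z_{k+1}) is multiplied by L at every left symbol.
  obtain ⟨L, hL1, hL2⟩ : ∃ L, 1 + (a - 1) / 2 ≤ L ∧ L ^ 2 - a * L + b = 0 := by
    refine ⟨(a + √(a ^ 2 - 4 * b)) / 2, ?_, ?_⟩
    · have : 1 ≤ √(a ^ 2 - 4 * b) := Real.le_sqrt_of_sq_le (by nlinarith)
      linarith
    · have := Real.sq_sqrt (show 0 ≤ a ^ 2 - 4 * b by nlinarith)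
      linear_combination this / 4
  obtain ⟨M, hM⟩ : ∃ M, M = a - L := ⟨_, rfl⟩
  have hLM : L * M = b := by rw [hM]; linear_combination -hL2
  have hL0 : 1 < L := by linarith
  have hM0 : 0 ≤ M := by
    by_contra hneg
    nlinarith
  have hMb : M ≤ b := by nlinarith
  have e0 := h.rec_first
  have e1 := h.rec_last
  have hX : 0 ≤ σ * z 0 := by
    have := hadm (m + n - 1) (by omega)
    rwa [h.signs.last, show m + n - 1 + 1 = m + n by omega, h.cyclic.per_zero] at this
  have hX' : z 0 ≤ σ * z 0 := by
    rcases h.sigma_eq with rfl | rfl <;> linarith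
  -- The last symbol enters here: σz_0 ≥ 0 contributes with a favourable sign and is dropped.
  have hD : 1 - (a - 1) ^ 2 - 2 * b - b ^ 2 ≤ (1 + z 2) - M * (1 + z 1) := by
    have y := hbd (m + n - 1) (by omega)
    have k1 : (1 + z 2) - M * (1 + z 1) = 1 - (a - 1) ^ 2 - b - a * M
        + ((a + M) * a * (σ * z 0) - b * z 0) + (a + M) * (b * (1 + z (m + n - 1))) := by
      rw [e0, e1]; ring
    have k2 : a * M = b + M ^ 2 := by rw [← hLM]; rw [hM]; ring
    have k3 : 0 ≤ (a + M) * (b * (1 + z (m + n - 1))) :=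
      mul_nonneg (by linarith) (mul_nonneg hb y.1)
    have k4 : b * z 0 ≤ (a + M) * a * (σ * z 0) := by
      calc b * z 0 ≤ b * (σ * z 0) := by gcongr
        _ ≤ _ := by
          apply mul_le_mul_of_nonneg_right _ hX
          nlinarith
    have k5 : M ^ 2 ≤ b ^ 2 := pow_le_pow_left₀ hM0 hMb 2
    linarith
  have hgrow : ∀ k, k + 2 ≤ m →
      (1 + z (k + 2)) - M * (1 + z (k + 1)) = L ^ k * ((1 + z 2) - M * (1 + z 1)) := by
    intro k
    induction k with
    | zero => intro _; simp
    | succ k ih =>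
      intro hk
      have e := h.rec_left (k := k) (by omega)
      have := ih (by omega)
      rw [pow_succ, mul_right_comm, ← this]
      rw [show k + 1 + 2 = k + 3 by omega, show k + 1 + 1 = k + 2 by omega]
      have hMa : a = L + M := by rw [hM]; ring
      rw [hMa, ← hLM] at e
      linear_combination -e
  -- After m - 3 expanding steps 1 + z_{m-1} exceeds 1, against the left symbol at position m - 2.
  have hfac := expanding_factor_gt_one hb hb' (t := a - 1) (by linarith) (by linarith) (m - 3)
    (by omega)
  have hg := hgrow (m - 3) (by omega)
  rw [show m - 3 + 2 = m - 1 by omega, show m - 3 + 1 = m - 2 by omega] at hg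
  have hs := hadm (m - 2) (by omega)
  have hl := h.signs.left (m - 3) (by omega)
  rw [show m - 3 + 1 = m - 2 by omega] at hl
  rw [hl, show m - 2 + 1 = m - 1 by omega] at hs
  have hpow : (1 + (a - 1) / 2) ^ (m - 3) ≤ L ^ (m - 3) :=
    pow_le_pow_left₀ (by linarith) hL1 _
  have hpos : 0 < (1 + (a - 1) / 2) ^ (m - 3) := pow_pos (by linarith) _
  have hD0 : 0 < 1 - (a - 1) ^ 2 - 2 * b - b ^ 2 := by
    by_contra hneg
    nlinarith
  have : 1 < L ^ (m - 3) * ((1 + z 2) - M * (1 + z 1)) :=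
    hfac.trans_le (mul_le_mul hpow hD hD0.le (hpos.le.trans hpow))
  have := mul_nonneg hM0 (hbd (m - 2) (by omega)).1
  linarith

end

/-! ## Cramer's formula and analytic dependence on the parameters -/

-- Parameters are ordered as (b, a), so that the implicit function theorem later solves for a in
-- terms of b.
open scoped ContDiff in
lemma contDiff_coordSeq (s : ℕ → ℝ) (θ : ℝ × ℝ) (k : ℕ) :
    ContDiff ℝ ω (fun p : ℝ × ℝ => coordSeq p.2 p.1 s θ k) := by
  induction k using Nat.twoStepInduction with
  | zero => exact contDiff_const
  | one => exact contDiff_const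
  | more k h1 h2 =>
    simp only [coordSeq]
    fun_prop

/-- The homogeneous solutions spanning the linear part of `coordSeq`. -/
noncomputable def coordSeqLin (a b : ℝ) (s : ℕ → ℝ) (θ : ℝ × ℝ) (k : ℕ) : ℝ :=
  coordSeq a b s θ k - coordSeq a b s 0 k

/-- Since the sequence is affine in the initial point, periodicity is a linear system of two
equations in two unknowns. -/
lemma coordSeq_eq (a b : ℝ) (s : ℕ → ℝ) (θ : ℝ × ℝ) (k : ℕ) :
    coordSeq a b s θ k = coordSeq a b s 0 k + θ.1 * coordSeqLin a b s (1, 0) k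
      + θ.2 * coordSeqLin a b s (0, 1) k := by
  induction k using Nat.twoStepInduction with
  | zero => simp [coordSeq, coordSeqLin]
  | one => simp [coordSeq, coordSeqLin]
  | more k h1 h2 =>
    simp only [coordSeqLin, coordSeq] at *
    rw [h1, h2]
    ring

/-- The determinant of the linear system for a periodic point of period `N`. -/
noncomputable def periodicDet (a b : ℝ) (s : ℕ → ℝ) (N : ℕ) : ℝ :=
  (1 - coordSeqLin a b s (1, 0) (N + 1)) * (1 - coordSeqLin a b s (0, 1) N) -
    coordSeqLin a b s (0, 1) (N + 1) * coordSeqLin a b s (1, 0) N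

/-- Cramer's formula for the periodic point of period `N`. -/
noncomputable def periodicPoint (a b : ℝ) (s : ℕ → ℝ) (N : ℕ) : ℝ × ℝ :=
  ((coordSeq a b s 0 (N + 1) * (1 - coordSeqLin a b s (0, 1) N) +
      coordSeqLin a b s (0, 1) (N + 1) * coordSeq a b s 0 N) / periodicDet a b s N,
    ((1 - coordSeqLin a b s (1, 0) (N + 1)) * coordSeq a b s 0 N +
      coordSeqLin a b s (1, 0) N * coordSeq a b s 0 (N + 1)) / periodicDet a b s N)

lemma periodicPoint_isCyclicSolution {a b : ℝ} {s : ℕ → ℝ} {N : ℕ}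
    (h : periodicDet a b s N ≠ 0) :
    IsCyclicSolution a b s N (coordSeq a b s (periodicPoint a b s N)) := by
  refine ⟨fun _ => rfl, ?_, ?_⟩
  · rw [coordSeq_eq a b s _ N]
    simp only [coordSeq, periodicPoint]
    field_simp
    simp only [periodicDet]
    ring
  · rw [coordSeq_eq a b s _ (N + 1)]
    simp only [coordSeq, periodicPoint]
    field_simp
    simp only [periodicDet]
    ring

lemma homogeneous_eq_zero {a b : ℝ} {s w : ℕ → ℝ} {N : ℕ} (hN : 0 < N) (hb : 0 ≤ b)
    (hab : b + 1 < a) (hs : ∀ k, s k = 1 ∨ s k = -1)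
    (hw : ∀ k, w (k + 2) = -(s k) * a * w (k + 1) - b * w k) (h0 : w N = w 0)
    (h1 : w (N + 1) = w 1) {k : ℕ} (hk : k ≤ N + 1) : w k = 0 := by
  have := mul_abs_le_of_cyclic (Q := 0) hN hb (by linarith) hs (z := w)
    (fun k _ => le_of_eq (by
      rw [hw k, abs_eq_zero]; ring)) h0 h1 hk hab.le
  have h2 := abs_nonneg (w k)
  exact abs_eq_zero.1 (by nlinarith)

/-- A kernel vector would be the initial value of a nonzero cyclic solution of the homogeneous
recursion, which the maximum principle excludes. -/
lemma periodicDet_ne_zero {a b : ℝ} {s : ℕ → ℝ} {N : ℕ} (hN : 0 < N) (hb : 0 ≤ b)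
    (hab : b + 1 < a) (hs : ∀ k, s k = 1 ∨ s k = -1) : periodicDet a b s N ≠ 0 := by
  intro hD
  let M : Matrix (Fin 2) (Fin 2) ℝ :=
    !![1 - coordSeqLin a b s (1, 0) (N + 1), -coordSeqLin a b s (0, 1) (N + 1);
      -coordSeqLin a b s (1, 0) N, 1 - coordSeqLin a b s (0, 1) N]
  have hM : M.det = 0 := by
    rw [Matrix.det_fin_two_of]; unfold periodicDet at hD; linear_combination hD
  obtain ⟨v, hv0, hv⟩ := Matrix.exists_mulVec_eq_zero_iff.2 hM
  have r0 := congrFun hv 0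
  have r1 := congrFun hv 1
  simp [M, Matrix.mulVec, dotProduct, Fin.sum_univ_two] at r0 r1
  have key := fun k (hk : k ≤ N + 1) => homogeneous_eq_zero (w := fun k =>
    v 0 * coordSeqLin a b s (1, 0) k + v 1 * coordSeqLin a b s (0, 1) k) hN hb hab hs
    (fun k => by simp only [coordSeqLin, coordSeq]; ring)
    (by simp only [coordSeqLin, coordSeq] at *; norm_num at *; linarith)
    (by simp only [coordSeqLin, coordSeq] at *; norm_num at *; linarith) hk
  have k0 := key 0 (by omega)
  have k1 := key 1 (by omega)
  simp [coordSeqLin, coordSeq] at k0 k1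
  apply hv0
  ext i
  fin_cases i
  · exact k1
  · exact k0

lemma IsFormalPeriodic.unique {a b : ℝ} {I : List ℤˣ} {θ θ' : ℝ × ℝ}
    (h : IsFormalPeriodic a b I θ) (h' : IsFormalPeriodic a b I θ') (hI : 0 < I.length)
    (hb : 0 ≤ b) (hab : b + 1 < a) : θ = θ' := by
  have c := coordSeq_isCyclicSolution h
  have c' := coordSeq_isCyclicSolution h'
  have key := fun k (hk : k ≤ I.length + 1) => homogeneous_eq_zero (w := fun k =>
    coordSeq a b (wordSign I) θ k - coordSeq a b (wordSign I) θ' k) hI hb hab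
    (wordSign_eq_one_or I) (fun k => by simp only [coordSeq]; ring)
    (by rw [c.per_zero, c'.per_zero]) (by rw [c.per_one, c'.per_one]) hk
  have k0 := key 0 (by omega)
  have k1 := key 1 (by omega)
  simp only [coordSeq] at k0 k1
  exact Prod.ext (sub_eq_zero.1 k1) (sub_eq_zero.1 k0)

lemma isFormalPeriodic_periodicPoint {a b : ℝ} {I : List ℤˣ} (hI : 0 < I.length)
    (hb : 0 ≤ b) (hab : b + 1 < a) :
    IsFormalPeriodic a b I (periodicPoint a b (wordSign I) I.length) := by
  have := periodicPoint_isCyclicSolution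
    (periodicDet_ne_zero hI hb hab (wordSign_eq_one_or I))
  exact (isFormalPeriodic_iff _ _ _ _).2 ⟨this.per_zero, this.per_one⟩

lemma existsUnique_isFormalPeriodic {a b : ℝ} {I : List ℤˣ} (hI : 0 < I.length)
    (hb : 0 ≤ b) (hab : b + 1 < a) : ∃! θ, IsFormalPeriodic a b I θ :=
  ⟨_, isFormalPeriodic_periodicPoint hI hb hab, fun _ h =>
    h.unique (isFormalPeriodic_periodicPoint hI hb hab) hI hb hab⟩

lemma isFormalPeriodic_formalPoint {a b : ℝ} {I : List ℤˣ} (hI : 0 < I.length)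
    (hb : 0 ≤ b) (hab : b + 1 < a) : IsFormalPeriodic a b I (formalPoint a b I) :=
  Classical.epsilon_spec (existsUnique_isFormalPeriodic hI hb hab).exists

lemma formalPoint_eq_periodicPoint {a b : ℝ} {I : List ℤˣ} (hI : 0 < I.length)
    (hb : 0 ≤ b) (hab : b + 1 < a) :
    formalPoint a b I = periodicPoint a b (wordSign I) I.length :=
  (isFormalPeriodic_formalPoint hI hb hab).unique
    (isFormalPeriodic_periodicPoint hI hb hab) hI hb hab

open scoped ContDiff in
lemma contDiff_periodicDet (s : ℕ → ℝ) (N : ℕ) :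
    ContDiff ℝ ω (fun p : ℝ × ℝ => periodicDet p.2 p.1 s N) := by
  have := contDiff_coordSeq s
  simp only [periodicDet, coordSeqLin]
  fun_prop

open scoped ContDiff in
lemma contDiffAt_periodicPoint {s : ℕ → ℝ} {N : ℕ} {p : ℝ × ℝ}
    (h : periodicDet p.2 p.1 s N ≠ 0) :
    ContDiffAt ℝ ω (fun p : ℝ × ℝ => periodicPoint p.2 p.1 s N) p := by
  have h1 := contDiff_coordSeq s
  have h2 := contDiff_periodicDet s N
  simp only [periodicPoint, coordSeqLin]
  refine ContDiffAt.prodMk (ContDiffAt.div ?_ h2.contDiffAt h) (ContDiffAt.div ?_ h2.contDiffAt h)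
    <;> exact ContDiff.contDiffAt (by fun_prop)

/-- The coordinate sequence of the periodic point. -/
noncomputable def periodicSeq (a b : ℝ) (s : ℕ → ℝ) (N : ℕ) : ℕ → ℝ :=
  coordSeq a b s (periodicPoint a b s N)

/-- Differentiating the periodic point along a path of parameters. -/
lemma isVariation_deriv {A B : ℝ → ℝ} {p q t : ℝ} (hA : HasDerivAt A p t)
    (hB : HasDerivAt B q t) {s : ℕ → ℝ} {N : ℕ} (hD : periodicDet (A t) (B t) s N ≠ 0) :
    (∀ k, DifferentiableAt ℝ (fun t => periodicSeq (A t) (B t) s N k) t) ∧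
    IsVariation (A t) (B t) p q s (periodicSeq (A t) (B t) s N) N
      (fun k => deriv (fun t => periodicSeq (A t) (B t) s N k) t) := by
  have hpath : DifferentiableAt ℝ (fun t => (B t, A t)) t :=
    hB.differentiableAt.prodMk hA.differentiableAt
  have hT : DifferentiableAt ℝ (fun t => periodicPoint (A t) (B t) s N) t :=
    DifferentiableAt.comp t (f := fun t => (B t, A t))
      (g := fun p : ℝ × ℝ => periodicPoint p.2 p.1 s N)
      ((contDiffAt_periodicPoint hD).differentiableAt (by simp)) hpath
  have hdiff : ∀ k, DifferentiableAt ℝ (fun t => periodicSeq (A t) (B t) s N k) t := by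
    intro k
    have hA' := hA.differentiableAt
    have hB' := hB.differentiableAt
    induction k using Nat.twoStepInduction with
    | zero => exact hT.snd
    | one => exact hT.fst
    | more k h1 h2 =>
      simp only [periodicSeq, coordSeq] at *
      fun_prop
  -- Differentiating the periodicity identities needs them on a full neighbourhood, where B may be
  -- negative; there they come from the open condition that the determinant is nonzero, not from the
  -- maximum principle.
  have hev : ∀ᶠ t' in 𝓝 t, periodicDet (A t') (B t') s N ≠ 0 := by
    have hc : ContinuousAt (fun t => periodicDet (A t) (B t) s N) t :=
      ContinuousAt.comp (f := fun t => (B t, A t))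
        (g := fun p : ℝ × ℝ => periodicDet p.2 p.1 s N)
        (contDiff_periodicDet s N).continuous.continuousAt hpath.continuousAt
    exact hc.eventually_ne hD
  refine ⟨hdiff, fun k => ?_, ?_, ?_⟩
  · have h0 := (hdiff k).hasDerivAt
    have h1 := (hdiff (k + 1)).hasDerivAt
    have := ((((hA.const_mul (-(s k))).mul h1).sub (hB.mul h0)).add
      ((hA.sub hB).sub_const 1)).deriv
    refine Eq.trans ?_ (this.trans ?_)
    · rfl
    · ring
  · exact Filter.EventuallyEq.deriv_eq (hev.mono fun t' ht' =>
      (periodicPoint_isCyclicSolution ht').per_zero)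
  · exact Filter.EventuallyEq.deriv_eq (hev.mono fun t' ht' =>
      (periodicPoint_isCyclicSolution ht').per_one)

/-! ## The bifurcation curves -/

/-- A sign occurs only multiplied by its coordinate, so it may be changed freely where that
coordinate vanishes. -/
lemma coordSeq_congr {a b : ℝ} {s s' : ℕ → ℝ} {θ : ℝ × ℝ} {K : ℕ}
    (h : ∀ j, j + 2 ≤ K → s j * coordSeq a b s θ (j + 1) = s' j * coordSeq a b s θ (j + 1))
    {k : ℕ} (hk : k ≤ K) : coordSeq a b s θ k = coordSeq a b s' θ k := by
  induction k using Nat.twoStepInduction with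
  | zero => rfl
  | one => rfl
  | more k h1 h2 =>
    have e := h k hk
    simp only [coordSeq]
    rw [← h1 (by omega), ← h2 (by omega)]
    linear_combination -a * e

lemma wordSign_iota_congr (σ τ : ℤˣ) {m n k : ℕ} (hk : k < (iotaStem m n).length) :
    wordSign (iota σ m n) k = wordSign (iota τ m n) k := by
  simp [wordSign, iota, List.getElem?_append, hk]

section

variable {a b : ℝ} {m n : ℕ}

/-- If the critical coordinate vanishes, the formal point does not depend on the last symbol. -/
lemma IsFormalPeriodic.iota_congr {σ : ℤˣ} {θ : ℝ × ℝ} (hm : 2 ≤ m) (hn : 2 ≤ n)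
    (h : IsFormalPeriodic a b (iota σ m n) θ) (h0 : θ.2 = 0) (τ : ℤˣ) :
    IsFormalPeriodic a b (iota τ m n) θ := by
  have hl := length_iotaStem hm hn
  have c := coordSeq_isCyclicSolution h
  rw [length_iota σ hm hn] at c
  have key := fun k (hk : k ≤ m + n + 1) =>
    coordSeq_congr (a := a) (b := b) (s := wordSign (iota σ m n)) (s' := wordSign (iota τ m n))
      (θ := θ) (K := m + n + 1) (fun j hj => by
        rcases Nat.lt_or_ge j (m + n - 1) with hj' | hj'
        · rw [wordSign_iota_congr σ τ (by omega)]
        · obtain rfl : j = m + n - 1 := by omega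
          rw [show m + n - 1 + 1 = m + n by omega, c.per_zero]
          simp [coordSeq, h0]) hk
  rw [isFormalPeriodic_iff, length_iota τ hm hn, ← key _ (by omega), ← key _ le_rfl,
    ← key _ (by omega), ← key _ (by omega)]
  exact ⟨c.per_zero, c.per_one⟩

lemma isIotaSolution_of_isFormalPeriodic {σ : ℤˣ} {θ : ℝ × ℝ} (hm : 2 ≤ m)
    (hn : n = 2 ∨ n = 3) (h : IsFormalPeriodic a b (iota σ m n) θ) :
    IsIotaSolution a b m n ((σ : ℤ) : ℝ) (wordSign (iota σ m n))
      (coordSeq a b (wordSign (iota σ m n)) θ) := by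
  have hn' : 2 ≤ n := by omega
  have c := coordSeq_isCyclicSolution h
  rw [length_iota σ hm hn'] at c
  exact ⟨c, iotaSigns_wordSign σ hm hn', wordSign_eq_one_or _, hn⟩

/-- The coordinates of the formal `ι_{σ,m,n}`-periodic point, given by Cramer's formula. -/
noncomputable def iotaSeq (m n : ℕ) (σ : ℤˣ) (a b : ℝ) : ℕ → ℝ :=
  periodicSeq a b (wordSign (iota σ m n)) (m + n)

lemma theta_eq {σ : ℤˣ} (hm : 2 ≤ m) (hn : 2 ≤ n) (hb : 0 ≤ b) (hab : b + 1 < a) :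
    theta a b σ m n = periodicPoint a b (wordSign (iota σ m n)) (m + n) := by
  have hl := length_iota σ hm hn
  rw [theta, formalPoint_eq_periodicPoint (by omega) hb hab, hl]

lemma isFormalPeriodic_theta {σ : ℤˣ} (hm : 2 ≤ m) (hn : 2 ≤ n) (hb : 0 ≤ b)
    (hab : b + 1 < a) : IsFormalPeriodic a b (iota σ m n) (theta a b σ m n) :=
  isFormalPeriodic_formalPoint (by have := length_iota σ hm hn; omega) hb hab

lemma isIotaSolution_iotaSeq (σ : ℤˣ) (hm : 2 ≤ m) (hn : n = 2 ∨ n = 3) (hb : 0 ≤ b)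
    (hab : b + 1 < a) :
    IsIotaSolution a b m n ((σ : ℤ) : ℝ) (wordSign (iota σ m n)) (iotaSeq m n σ a b) := by
  have h := isFormalPeriodic_theta (σ := σ) hm (by omega) hb hab (n := n)
  rw [theta_eq hm (by omega) hb hab] at h
  exact isIotaSolution_of_isFormalPeriodic hm hn h

lemma periodicDet_iota_ne_zero (σ : ℤˣ) (hm : 2 ≤ m) (hb : 0 ≤ b)
    (hab : b + 1 < a) : periodicDet a b (wordSign (iota σ m n)) (m + n) ≠ 0 :=
  periodicDet_ne_zero (by omega) hb hab (wordSign_eq_one_or _)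

lemma isVariation_iotaSeq (σ : ℤˣ) (hm : 2 ≤ m) {A B : ℝ → ℝ} {p q t : ℝ}
    (hA : HasDerivAt A p t) (hB : HasDerivAt B q t) (hb : 0 ≤ B t) (hab : B t + 1 < A t) :
    (∀ k, DifferentiableAt ℝ (fun t => iotaSeq m n σ (A t) (B t) k) t) ∧
    IsVariation (A t) (B t) p q (wordSign (iota σ m n)) (iotaSeq m n σ (A t) (B t)) (m + n)
      (fun k => deriv (fun t => iotaSeq m n σ (A t) (B t) k) t) :=
  isVariation_deriv hA hB (periodicDet_iota_ne_zero σ hm hb hab)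

lemma hasDerivAt_critical (σ : ℤˣ) (hn : n = 2 ∨ n = 3) (hp : NearTent a b m) :
    ∃ d, HasDerivAt (fun a => iotaSeq m n σ a b 0) d a ∧ 0 < ((σ : ℤ) : ℝ) * d := by
  have hm : 2 ≤ m := by have := hp.m_ge; omega
  have hb := hp.b_nonneg
  have hab : b + 1 < a := by linarith [hp.b_le, hp.a_ge]
  obtain ⟨h1, h2⟩ := isVariation_iotaSeq (n := n) σ hm (hasDerivAt_id a) (hasDerivAt_const a b)
    hb hab
  exact ⟨_, (h1 0).hasDerivAt, h2.critical_pos (isIotaSolution_iotaSeq σ hm hn hb hab) hp⟩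

lemma nearTent_of_mem (hm : 60 ≤ m) (hb : b ∈ Icc (0 : ℝ) (1 / 10000))
    (ha : a ∈ Icc (99 / 50 : ℝ) (101 / 50)) : NearTent a b m :=
  ⟨ha.1, ha.2, hb.1, hb.2, hm⟩

lemma strictMonoOn_critical (σ : ℤˣ) (hm : 60 ≤ m) (hn : n = 2 ∨ n = 3)
    (hb : b ∈ Icc (0 : ℝ) (1 / 10000)) :
    StrictMonoOn (fun a => ((σ : ℤ) : ℝ) * iotaSeq m n σ a b 0)
      (Icc (99 / 50 : ℝ) (101 / 50)) := by
  refine strictMonoOn_of_deriv_pos (convex_Icc _ _) (fun a ha => ?_) (fun a ha => ?_)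
  · obtain ⟨d, hd, -⟩ := hasDerivAt_critical (n := n) σ hn (nearTent_of_mem hm hb ha)
    exact (hd.const_mul _).continuousAt.continuousWithinAt
  · obtain ⟨d, hd, hpos⟩ := hasDerivAt_critical (n := n) σ hn
      (nearTent_of_mem hm hb (interior_subset ha))
    rwa [(hd.const_mul _).deriv]

/-- At the two ends of the window a(a - 2) is about -1/25 and 1/25, well beyond the error 1/500 of
`critical_estimate`. -/
lemma exists_critical_eq_zero (hm : 60 ≤ m) (hn : n = 2 ∨ n = 3)
    (hb : b ∈ Icc (0 : ℝ) (1 / 10000)) :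
    ∃ a ∈ Ioo (99 / 50 : ℝ) (101 / 50), iotaSeq m n 1 a b 0 = 0 := by
  have hc : ContinuousOn (fun a => iotaSeq m n 1 a b 0) (Icc (99 / 50 : ℝ) (101 / 50)) := by
    intro a ha
    obtain ⟨d, hd, -⟩ := hasDerivAt_critical (n := n) 1 hn (nearTent_of_mem hm hb ha)
    exact hd.continuousAt.continuousWithinAt
  have est : ∀ a ∈ Icc (99 / 50 : ℝ) (101 / 50),
      |a ^ 2 * (1 * iotaSeq m n 1 a b 0) - a * (a - 2)| ≤ 1 / 500 := by
    intro a ha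
    have := (isIotaSolution_iotaSeq (a := a) 1 (by omega) hn hb.1
      (by linarith [hb.2, ha.1])).critical_estimate (nearTent_of_mem hm hb ha)
    simpa using this
  have e1 := abs_le.1 (est (99 / 50) (by norm_num))
  have e2 := abs_le.1 (est (101 / 50) (by norm_num))
  have := intermediate_value_Ioo (by norm_num) hc (show (0 : ℝ) ∈ Ioo _ _ from
    ⟨by linarith, by linarith⟩)
  exact this

/-- The bifurcation curve. -/
noncomputable def bifCurve (m n : ℕ) (b : ℝ) : ℝ :=
  Classical.epsilon fun a => a ∈ Ioo (99 / 50 : ℝ) (101 / 50) ∧ iotaSeq m n 1 a b 0 = 0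

lemma bifCurve_spec (hm : 60 ≤ m) (hn : n = 2 ∨ n = 3) (hb : b ∈ Icc (0 : ℝ) (1 / 10000)) :
    bifCurve m n b ∈ Ioo (99 / 50 : ℝ) (101 / 50) ∧ iotaSeq m n 1 (bifCurve m n b) b 0 = 0 :=
  Classical.epsilon_spec (exists_critical_eq_zero hm hn hb)

lemma eq_bifCurve (hm : 60 ≤ m) (hn : n = 2 ∨ n = 3) (hb : b ∈ Icc (0 : ℝ) (1 / 10000))
    (ha : a ∈ Ioo (99 / 50 : ℝ) (101 / 50)) (h0 : iotaSeq m n 1 a b 0 = 0) :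
    a = bifCurve m n b := by
  obtain ⟨h1, h2⟩ := bifCurve_spec hm hn hb
  exact (strictMonoOn_critical 1 hm hn hb).injOn (Ioo_subset_Icc_self ha)
    (Ioo_subset_Icc_self h1) (by simp [h0, h2])

/-- The curve is defined through σ = 1 only; since the critical coordinate vanishes on it, it serves
both last symbols. -/
lemma theta_bifCurve_eq (hm : 60 ≤ m) (hn : n = 2 ∨ n = 3)
    (hb : b ∈ Icc (0 : ℝ) (1 / 10000)) (σ : ℤˣ) :
    theta (bifCurve m n b) b σ m n = theta (bifCurve m n b) b 1 m n ∧
      (theta (bifCurve m n b) b σ m n).2 = 0 := by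
  obtain ⟨h1, h2⟩ := bifCurve_spec hm hn hb
  have hab : b + 1 < bifCurve m n b := by linarith [h1.1, hb.2]
  have hn' : 2 ≤ n := by omega
  have h0 : (theta (bifCurve m n b) b 1 m n).2 = 0 := by
    rw [theta_eq (by omega) hn' hb.1 hab]; exact h2
  have e := ((isFormalPeriodic_theta (by omega) hn' hb.1 hab).iota_congr (by omega) hn' h0
    σ).unique (isFormalPeriodic_theta (by omega) hn' hb.1 hab)
    (by rw [length_iota σ (by omega) hn']; omega) hb.1 hab
  exact ⟨e.symm, by rw [← e]; exact h0⟩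

lemma iotaSeq_bifCurve (hm : 60 ≤ m) (hn : n = 2 ∨ n = 3)
    (hb : b ∈ Icc (0 : ℝ) (1 / 10000)) (σ : ℤˣ) :
    iotaSeq m n σ (bifCurve m n b) b 0 = 0 := by
  obtain ⟨h1, h2⟩ := bifCurve_spec hm hn hb
  have := (theta_bifCurve_eq hm hn hb σ).2
  rwa [theta_eq (by omega) (by omega) hb.1 (by linarith [h1.1, hb.2])] at this

lemma iotaSeq_last (σ : ℤˣ) (hm : 2 ≤ m) (hn : n = 2 ∨ n = 3) (hb : 0 ≤ b)
    (hab : b + 1 < a) :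
    wordSign (iota σ m n) (m + n - 1) * iotaSeq m n σ a b (m + n - 1 + 1) =
      ((σ : ℤ) : ℝ) * iotaSeq m n σ a b 0 := by
  have h := isIotaSolution_iotaSeq σ hm hn hb hab
  rw [h.signs.last, show m + n - 1 + 1 = m + n by omega, h.cyclic.per_zero]

lemma iotaSeq_pos (σ : ℤˣ) (hm : 60 ≤ m) (hn : n = 2 ∨ n = 3)
    (hb : b ∈ Icc (0 : ℝ) (1 / 10000)) (ha : bifCurve m n b < a) {k : ℕ} (hk : k < m + n) :
    0 < wordSign (iota σ m n) k * iotaSeq m n σ a b (k + 1) := by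
  obtain ⟨h1, h2⟩ := bifCurve_spec hm hn hb
  have hab : b + 1 < a := by linarith [h1.1, hb.2]
  have h := isIotaSolution_iotaSeq (m := m) σ (by omega) hn hb.1 hab
  rcases le_or_gt a (101 / 50) with ha' | ha'
  · have hmem : a ∈ Icc (99 / 50 : ℝ) (101 / 50) := ⟨by linarith [h1.1], ha'⟩
    rcases Nat.lt_or_ge (k + 1) (m + n) with hk' | hk'
    · exact h.pos_of_nearTent (nearTent_of_mem hm hb hmem) hk'
    · obtain rfl : k = m + n - 1 := by omega
      rw [iotaSeq_last σ (by omega) hn hb.1 hab]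
      have := strictMonoOn_critical σ hm hn hb (Ioo_subset_Icc_self h1) hmem ha
      simpa [iotaSeq_bifCurve hm hn hb σ] using this
  · exact h.pos_of_large hb.1 (by linarith [hb.2]) hk

lemma iotaSeq_nonneg (σ : ℤˣ) (hm : 60 ≤ m) (hn : n = 2 ∨ n = 3)
    (hb : b ∈ Icc (0 : ℝ) (1 / 10000)) {k : ℕ} (hk : k < m + n) :
    0 ≤ wordSign (iota σ m n) k * iotaSeq m n σ (bifCurve m n b) b (k + 1) := by
  obtain ⟨h1, h2⟩ := bifCurve_spec hm hn hb
  have hab : b + 1 < bifCurve m n b := by linarith [h1.1, hb.2]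
  rcases Nat.lt_or_ge (k + 1) (m + n) with hk' | hk'
  · have h := isIotaSolution_iotaSeq (m := m) σ (by omega) hn hb.1 hab
    exact (h.pos_of_nearTent (nearTent_of_mem hm hb (Ioo_subset_Icc_self h1)) hk').le
  · obtain rfl : k = m + n - 1 := by omega
    rw [iotaSeq_last σ (by omega) hn hb.1 hab, iotaSeq_bifCurve hm hn hb σ, mul_zero]

lemma iotaSeq_not_nonneg (σ : ℤˣ) (hm : 60 ≤ m) (hn : n = 2 ∨ n = 3)
    (hb : b ∈ Icc (0 : ℝ) (1 / 10000)) (hab : 3 * b + 1 < a) (ha : a < bifCurve m n b) :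
    ¬ ∀ k < m + n, 0 ≤ wordSign (iota σ m n) k * iotaSeq m n σ a b (k + 1) := by
  intro hadm
  obtain ⟨h1, h2⟩ := bifCurve_spec hm hn hb
  have hab' : b + 1 < a := by linarith [hb.1]
  rcases lt_or_ge a (99 / 50) with ha' | ha'
  · exact (isIotaSolution_iotaSeq σ (by omega) hn hb.1 hab').not_admissible hm hb.1 hb.2 hab ha'
      hadm
  · have hmem : a ∈ Icc (99 / 50 : ℝ) (101 / 50) := ⟨ha', by linarith [h1.2]⟩
    have := strictMonoOn_critical σ hm hn hb hmem (Ioo_subset_Icc_self h1) ha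
    have h3 := hadm (m + n - 1) (by omega)
    rw [iotaSeq_last σ (by omega) hn hb.1 hab'] at h3
    simp only [iotaSeq_bifCurve hm hn hb σ, mul_zero] at this
    linarith

open scoped ContDiff in
/-- Near each of its points the bifurcation curve is the graph of an analytic function. -/
lemma exists_analyticAt_eq_bifCurve (hm : 60 ≤ m) (hn : n = 2 ∨ n = 3)
    (hb : b ∈ Icc (0 : ℝ) (1 / 10000)) :
    ∃ φ : ℝ → ℝ, AnalyticAt ℝ φ b ∧ φ b = bifCurve m n b ∧
      (∀ᶠ t in 𝓝 b, iotaSeq m n 1 (φ t) t 0 = 0) ∧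
      ∀ᶠ t in 𝓝[Icc (0 : ℝ) (1 / 10000)] b, bifCurve m n t = φ t := by
  obtain ⟨h1, h2⟩ := bifCurve_spec hm hn hb
  have hab : b + 1 < bifCurve m n b := by linarith [h1.1, hb.2]
  let f : ℝ × ℝ → ℝ := fun p => iotaSeq m n 1 p.2 p.1 0
  have cdf : ContDiffAt ℝ ω f (b, bifCurve m n b) :=
    ContDiffAt.snd (contDiffAt_periodicPoint (s := wordSign (iota 1 m n)) (N := m + n)
      (p := (b, bifCurve m n b)) (periodicDet_iota_ne_zero 1 (by omega) hb.1 hab))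
  obtain ⟨d, hd, hd0⟩ := hasDerivAt_critical (n := n) 1 hn
    (nearTent_of_mem hm hb (Ioo_subset_Icc_self h1))
  have hd0' : d ≠ 0 := by
    rintro rfl
    simp at hd0
  -- The partial derivative in a is multiplication by d, nonzero by monotonicity of the critical
  -- coordinate.
  have hinv : (fderiv ℝ f (b, bifCurve m n b) ∘L .inr ℝ ℝ ℝ).IsInvertible := by
    refine ⟨ContinuousLinearEquiv.unitsEquivAut ℝ (Units.mk0 d hd0'), ?_⟩
    have hf : HasFDerivAt f (fderiv ℝ f (b, bifCurve m n b)) (b, bifCurve m n b) :=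
      (cdf.differentiableAt (by simp)).hasFDerivAt
    have := (hf.comp (bifCurve m n b)
      (hasFDerivAt_prodMk_right b (bifCurve m n b))).hasDerivAt.unique hd
    ext
    simpa using this.symm
  have hne : (ω : WithTop ℕ∞) ≠ 0 := by simp
  refine ⟨cdf.implicitFunction hne hinv, ?_, ?_, ?_, ?_⟩
  · exact (cdf.contDiffAt_implicitFunction hne hinv).analyticAt
  · exact cdf.implicitFunction_apply_self hne hinv
  · refine (cdf.eventually_apply_implicitFunction hne hinv).mono fun t ht => ?_
    exact ht.trans h2
  · have hc : ContinuousAt (cdf.implicitFunction hne hinv) b :=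
      (cdf.contDiffAt_implicitFunction hne hinv).continuousAt
    have hself : cdf.implicitFunction hne hinv b = bifCurve m n b :=
      cdf.implicitFunction_apply_self hne hinv
    have hmem : ∀ᶠ t in 𝓝 b, cdf.implicitFunction hne hinv t ∈ Ioo (99 / 50 : ℝ) (101 / 50) :=
      hc.eventually_mem (by rw [hself]; exact isOpen_Ioo.mem_nhds h1)
    -- By continuity the implicit function stays in the window of a where the zero is unique;
    -- uniqueness is available only for b in the closed interval.
    filter_upwards [self_mem_nhdsWithin, mem_nhdsWithin_of_mem_nhds hmem,
      mem_nhdsWithin_of_mem_nhds (cdf.eventually_apply_implicitFunction hne hinv)]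
      with t ht1 ht2 ht3
    exact (eq_bifCurve hm hn ht1 ht2 (ht3.trans h2)).symm

lemma analyticOn_bifCurve (hm : 60 ≤ m) (hn : n = 2 ∨ n = 3) :
    AnalyticOn ℝ (bifCurve m n) (Icc (0 : ℝ) (1 / 10000)) := by
  intro b hb
  obtain ⟨φ, h1, h2, -, h3⟩ := exists_analyticAt_eq_bifCurve hm hn hb
  exact h1.analyticWithinAt.congr_of_eventuallyEq h3 h2.symm

/-- The local extension φ is analytic on a full neighbourhood, so even at the end points the
one-sided slope of the curve is an ordinary derivative of φ, along which z_0 stays 0. -/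
lemma exists_isVariation_bifCurve (hm : 60 ≤ m) (hn : n = 2 ∨ n = 3)
    (hb : b ∈ Icc (0 : ℝ) (1 / 10000)) :
    ∃ w : ℕ → ℝ, w 0 = 0 ∧
      IsVariation (bifCurve m n b) b (derivWithin (bifCurve m n) (Icc (0 : ℝ) (1 / 10000)) b) 1
        (wordSign (iota 1 m n)) (iotaSeq m n 1 (bifCurve m n b) b) (m + n) w := by
  obtain ⟨φ, h1, h2, h4, h3⟩ := exists_analyticAt_eq_bifCurve hm hn hb
  obtain ⟨h5, -⟩ := bifCurve_spec hm hn hb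
  have hφ : HasDerivAt φ (deriv φ b) b := h1.differentiableAt.hasDerivAt
  have hder : derivWithin (bifCurve m n) (Icc (0 : ℝ) (1 / 10000)) b = deriv φ b := by
    have hu : UniqueDiffWithinAt ℝ (Icc (0 : ℝ) (1 / 10000)) b :=
      uniqueDiffOn_Icc (by norm_num) b hb
    exact (hφ.hasDerivWithinAt.congr_of_eventuallyEq h3 h2.symm).derivWithin hu
  have hv := (isVariation_iotaSeq (n := n) (m := m) 1 (by omega) hφ (hasDerivAt_id b)
    hb.1 (by rw [h2]; simp only [id]; linarith [h5.1, hb.2])).2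
  rw [h2, ← hder] at hv
  refine ⟨_, ?_, hv⟩
  exact (Filter.EventuallyEq.deriv_eq h4).trans (deriv_const b (0 : ℝ))

lemma derivWithin_bifCurve_lt (hm : 60 ≤ m) (hb : b ∈ Icc (0 : ℝ) (1 / 10000)) :
    derivWithin (bifCurve m 3) (Icc (0 : ℝ) (1 / 10000)) b <
      derivWithin (bifCurve m 2) (Icc (0 : ℝ) (1 / 10000)) b := by
  obtain ⟨w, hw0, hw⟩ := exists_isVariation_bifCurve (n := 2) hm (Or.inl rfl) hb
  obtain ⟨w', hw0', hw'⟩ := exists_isVariation_bifCurve (n := 3) hm (Or.inr rfl) hb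
  have h2 := (bifCurve_spec (n := 2) hm (Or.inl rfl) hb).1
  have h3 := (bifCurve_spec (n := 3) hm (Or.inr rfl) hb).1
  have p2 := hw.slope_pos (isIotaSolution_iotaSeq 1 (by omega) (Or.inl rfl) hb.1
    (by linarith [hb.2, h2.1])) (nearTent_of_mem hm hb (Ioo_subset_Icc_self h2))
    (iotaSeq_bifCurve hm (Or.inl rfl) hb 1) hw0
  have p3 := hw'.slope_neg (isIotaSolution_iotaSeq 1 (by omega) (Or.inr rfl) hb.1
    (by linarith [hb.2, h3.1])) (nearTent_of_mem hm hb (Ioo_subset_Icc_self h3))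
    (iotaSeq_bifCurve hm (Or.inr rfl) hb 1) hw0'
  exact p3.trans p2

end

/-! ## Steep lines and their pullbacks -/

/-- The value at height `y` of the line `x = c + s y` with parameters `p = (c, s)`. -/
noncomputable def lineAt (p : ℝ × ℝ) (y : ℝ) : ℝ := p.1 + p.2 * y

/-- The signed horizontal distance from the line with parameters `p`. -/
noncomputable def lineFn (p v : ℝ × ℝ) : ℝ := v.1 - lineAt p v.2

/-- The line that the affine branch `Λ_σ` maps into the line with parameters `p`. -/
noncomputable def pullLine (a b : ℝ) (σ : ℤˣ) (p : ℝ × ℝ) : ℝ × ℝ :=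
  ((a - b - 1 - p.1) / (((σ : ℤ) : ℝ) * a + p.2), -b / (((σ : ℤ) : ℝ) * a + p.2))

/-- Steep lines crossing the square `[-1, 1]²` from bottom to top. -/
structure IsSteep (p : ℝ × ℝ) : Prop where
  slope_ge : -(1 / 2) ≤ p.2
  slope_le : p.2 ≤ 1 / 2
  ge : ∀ y ∈ Icc (-1 : ℝ) 1, -1 ≤ lineAt p y
  le : ∀ y ∈ Icc (-1 : ℝ) 1, lineAt p y ≤ 1

/-- Strict left-to-right order of lines in the strip. -/
def LeftOf (p q : ℝ × ℝ) : Prop := ∀ y ∈ Icc (-1 : ℝ) 1, lineAt p y < lineAt q y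

/-- Parameters with `a` close to `2` or larger and `b` small. -/
structure Wide (a b : ℝ) : Prop where
  a_ge : 99 / 50 ≤ a
  b_nonneg : 0 ≤ b
  b_le : b ≤ 1 / 10000

section

variable {a b : ℝ} {p q v : ℝ × ℝ} {σ : ℤˣ}

lemma IsSteep.den_ne_zero (hp : IsSteep p) (h : Wide a b) (σ : ℤˣ) :
    ((σ : ℤ) : ℝ) * a + p.2 ≠ 0 := by
  have h1 := h.a_ge
  have h2 := hp.slope_ge
  have h3 := hp.slope_le
  rcases Int.units_eq_one_or σ with rfl | rfl
  · simp; linarith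
  · simp; linarith

/-- The factor σa + p.2 has the sign of σ, so Λ_- preserves the sides of a line and Λ_+ exchanges
them. -/
lemma lineFn_branch (hp : IsSteep p) (h : Wide a b) (σ : ℤˣ) (v : ℝ × ℝ) :
    lineFn p (branch a b σ v) =
      -(((σ : ℤ) : ℝ) * a + p.2) * lineFn (pullLine a b σ p) v := by
  have := hp.den_ne_zero h σ
  simp only [lineFn, lineAt, branch, pullLine]
  field_simp
  ring

lemma lineFn_branch_pos (hp : IsSteep p) (h : Wide a b) (v : ℝ × ℝ) :
    lineFn p (branch a b 1 v) = -(a + p.2) * lineFn (pullLine a b 1 p) v := by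
  simpa using lineFn_branch hp h 1 v

lemma lineFn_branch_neg (hp : IsSteep p) (h : Wide a b) (v : ℝ × ℝ) :
    lineFn p (branch a b (-1) v) = (a - p.2) * lineFn (pullLine a b (-1) p) v := by
  rw [lineFn_branch hp h (-1) v, Units.val_neg, Units.val_one, Int.cast_neg, Int.cast_one]
  ring

lemma pullLine_slope (hp : IsSteep p) (h : Wide a b) (σ : ℤˣ) :
    |(pullLine a b σ p).2| ≤ b := by
  have h1 := h.a_ge
  have h2 := hp.slope_ge
  have h3 := hp.slope_le
  simp only [pullLine]
  rw [abs_div, abs_neg, abs_of_nonneg h.b_nonneg]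
  apply div_le_self h.b_nonneg
  rcases Int.units_eq_one_or σ with rfl | rfl
  · simp only [Units.val_one, Int.cast_one, one_mul]
    rw [abs_of_nonneg (by linarith)]; linarith
  · simp only [Units.val_neg, Units.val_one, Int.cast_neg, Int.cast_one, neg_mul, one_mul]
    rw [abs_of_nonpos (by linarith)]; linarith

/-- For |y| ≤ 1, Λ_σ maps (σ, y) to first coordinate -1 - b(1 + y) ≤ -1 and (-σ, y) to 2a - 1 - b(1
+ y) ≥ 1. The two vertical edges of the square land on opposite sides of p, so the pulled-back line
runs between them. -/
lemma IsSteep.pullLine (hp : IsSteep p) (h : Wide a b) (σ : ℤˣ) :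
    IsSteep (pullLine a b σ p) := by
  have h1 := h.a_ge
  have h2 := hp.slope_ge
  have h3 := hp.slope_le
  have h4 := h.b_nonneg
  have h5 := h.b_le
  have hs := abs_le.1 (pullLine_slope hp h σ)
  have g1 := hp.ge 1 (by norm_num)
  have g2 := hp.ge (-1) (by norm_num)
  have l1 := hp.le 1 (by norm_num)
  have l2 := hp.le (-1) (by norm_num)
  simp only [lineAt] at g1 g2 l1 l2
  have key : ∀ y ∈ Icc (-1 : ℝ) 1, -1 ≤ lineAt (Lozi.pullLine a b σ p) y ∧
      lineAt (Lozi.pullLine a b σ p) y ≤ 1 := by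
    intro y hy
    obtain ⟨y1, y2⟩ := hy
    rcases Int.units_eq_one_or σ with rfl | rfl
    · have e1 := lineFn_branch_pos hp h (1, y)
      have e2 := lineFn_branch_pos hp h (-1, y)
      simp only [lineFn, branch, lineAt, Units.val_one, Int.cast_one] at e1 e2 ⊢
      constructor
      · by_contra! hc
        nlinarith
      · by_contra! hc
        nlinarith
    · have e1 := lineFn_branch_neg hp h (1, y)
      have e2 := lineFn_branch_neg hp h (-1, y)
      simp only [lineFn, branch, lineAt, Units.val_neg, Units.val_one, Int.cast_neg,
        Int.cast_one] at e1 e2 ⊢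
      constructor
      · by_contra! hc
        nlinarith
      · by_contra! hc
        nlinarith
  exact ⟨by linarith, by linarith, fun y hy => (key y hy).1, fun y hy => (key y hy).2⟩

lemma mem_vseg_iff : v ∈ vseg p.1 p.2 ↔ v ∈ strip ∧ lineFn p v = 0 := by
  simp only [vseg, lineFn, lineAt, mem_ofPred_eq, sub_eq_zero]

lemma branch_mem_strip (h1 : -1 ≤ v.1) (h2 : v.1 ≤ 1) : branch a b σ v ∈ strip :=
  ⟨h1, h2⟩

/-- No part is cut off: the first coordinate of a point is the height of its image, and the
pulled-back line stays in |x| ≤ 1. -/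
lemma pullback_vseg (hp : IsSteep p) (h : Wide a b) (σ : ℤˣ) :
    pullback a b σ (vseg p.1 p.2) = vseg (pullLine a b σ p).1 (pullLine a b σ p).2 := by
  have hq := hp.pullLine h σ
  ext v
  rw [mem_vseg_iff, pullback, mem_inter_iff, mem_preimage, mem_vseg_iff,
    lineFn_branch hp h, mul_eq_zero, neg_eq_zero, or_iff_right (hp.den_ne_zero h σ)]
  constructor
  · rintro ⟨⟨-, h1⟩, h2⟩
    exact ⟨h2, h1⟩
  · rintro ⟨h1, h2⟩
    have h3 : v.1 = lineAt (pullLine a b σ p) v.2 := sub_eq_zero.1 h2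
    exact ⟨⟨branch_mem_strip (by rw [h3]; exact hq.ge _ h1) (by rw [h3]; exact hq.le _ h1), h2⟩,
      h1⟩

lemma lineFn_of_eq (y : ℝ) : lineFn p (lineAt p y, y) = 0 := by simp [lineFn]

lemma LeftOf.pullLine_neg (hpq : LeftOf p q) (hp : IsSteep p) (hq : IsSteep q) (h : Wide a b) :
    LeftOf (pullLine a b (-1) p) (pullLine a b (-1) q) := by
  intro y hy
  have hP := hp.pullLine h (-1)
  have e1 := lineFn_branch_neg hp h (lineAt (pullLine a b (-1) p) y, y)
  have e2 := lineFn_branch_neg hq h (lineAt (pullLine a b (-1) p) y, y)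
  rw [lineFn_of_eq, mul_zero] at e1
  have := hpq (lineAt (pullLine a b (-1) p) y) ⟨hP.ge y hy, hP.le y hy⟩
  simp only [lineFn, branch] at e1 e2
  have h1 := h.a_ge
  have h3 := hq.slope_le
  by_contra! hc
  nlinarith

lemma LeftOf.pullLine_pos (hpq : LeftOf p q) (hp : IsSteep p) (hq : IsSteep q) (h : Wide a b) :
    LeftOf (pullLine a b 1 q) (pullLine a b 1 p) := by
  intro y hy
  have hP := hp.pullLine h 1
  have e1 := lineFn_branch_pos hp h (lineAt (pullLine a b 1 p) y, y)
  have e2 := lineFn_branch_pos hq h (lineAt (pullLine a b 1 p) y, y)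
  rw [lineFn_of_eq, mul_zero] at e1
  have := hpq (lineAt (pullLine a b 1 p) y) ⟨hP.ge y hy, hP.le y hy⟩
  simp only [lineFn, branch] at e1 e2
  have h1 := h.a_ge
  have h3 := hq.slope_ge
  by_contra! hc
  nlinarith

/-- A line whose pullbacks do not meet the critical locus. -/
def IsLow (a b : ℝ) (p : ℝ × ℝ) : Prop := p.1 < a - 1 - 2 * b

/-- Both branches map (0, y) to (a - b - 1 - by, 0), whose first coordinate is at least a - 1 - 2b.
The image of the critical locus thus lies to the right of a low line, and the pullbacks cannot meet
x = 0. -/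
lemma IsLow.pullLine_side (hl : IsLow a b p) (hp : IsSteep p) (h : Wide a b) (σ : ℤˣ) {y : ℝ}
    (hy : y ∈ Icc (-1 : ℝ) 1) : 0 < ((σ : ℤ) : ℝ) * lineAt (pullLine a b σ p) y := by
  have h1 := h.a_ge
  have h2 := hp.slope_ge
  have h3 := hp.slope_le
  have h4 := h.b_nonneg
  unfold IsLow at hl
  obtain ⟨y1, y2⟩ := hy
  have e := lineFn_branch hp h σ (lineAt (pullLine a b σ p) y, y)
  rw [lineFn_of_eq, mul_zero] at e
  simp only [lineFn, lineAt, branch] at e ⊢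
  rcases Int.units_eq_one_or σ with rfl | rfl
  · simp only [Units.val_one, Int.cast_one] at *
    by_contra! hc
    nlinarith
  · simp only [Units.val_neg, Units.val_one, Int.cast_neg, Int.cast_one] at *
    by_contra! hc
    nlinarith

lemma mem_vstrip_iff (hpq : LeftOf p q) :
    v ∈ vstrip (vseg p.1 p.2) (vseg q.1 q.2) ↔ v ∈ strip ∧ 0 ≤ lineFn p v ∧ lineFn q v ≤ 0 := by
  constructor
  · rintro ⟨hv, x₁, x₂, h1, h2, h3⟩
    have e1 : x₁ = lineAt p v.2 := h1.2
    have e2 : x₂ = lineAt q v.2 := h2.2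
    have hlt := hpq v.2 hv
    rw [e1, e2, uIcc_of_le hlt.le] at h3
    exact ⟨hv, sub_nonneg.2 h3.1, sub_nonpos.2 h3.2⟩
  · rintro ⟨hv, h1, h2⟩
    refine ⟨hv, lineAt p v.2, lineAt q v.2, ⟨hv, rfl⟩, ⟨hv, rfl⟩, ?_⟩
    rw [uIcc_of_le (hpq v.2 hv).le]
    exact ⟨sub_nonneg.1 h1, sub_nonpos.1 h2⟩

lemma mem_stableSet_of_lozi {z : ℝ × ℝ} (h : lozi a b v ∈ stableSet a b z) :
    v ∈ stableSet a b z := by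
  have h' : Tendsto (fun k : ℕ => (lozi a b)^[k] (lozi a b v)) atTop (𝓝 z) := h
  exact (tendsto_add_atTop_iff_nat 1).1 h'

/-- On the correct side of x = 0 the affine branch is the Lozi map itself, so stability is
inherited. -/
lemma vseg_pullLine_subset_stableSet {z : ℝ × ℝ} (hl : IsLow a b p) (hp : IsSteep p)
    (h : Wide a b) (σ : ℤˣ) (hs : vseg p.1 p.2 ⊆ stableSet a b z) :
    vseg (pullLine a b σ p).1 (pullLine a b σ p).2 ⊆ stableSet a b z := by
  intro v hv
  have hside : 0 ≤ ((σ : ℤ) : ℝ) * v.1 := by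
    have := hl.pullLine_side hp h σ hv.1
    have e : v.1 = lineAt (pullLine a b σ p) v.2 := hv.2
    rw [e]; exact this.le
  rw [← pullback_vseg hp h σ] at hv
  apply mem_stableSet_of_lozi
  rw [lozi_eq_branch a b hside]
  exact hs hv.1

end

/-! ## The lines containing `β_k` and `γ_k` -/

section

variable {a b : ℝ}

lemma lam_spec (h : Wide a b) : 1 ≤ lam a b ∧ lam a b + mu a b = a ∧ lam a b * mu a b = b ∧
    0 ≤ mu a b ∧ mu a b ≤ b := by
  have h1 := h.a_ge
  have h2 := h.b_nonneg
  have h3 := h.b_le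
  have hL : 1 ≤ lam a b := by
    have : 2 - a ≤ √(a ^ 2 - 4 * b) := Real.le_sqrt_of_sq_le (by nlinarith)
    unfold lam; linarith
  have hq : lam a b ^ 2 - a * lam a b + b = 0 := by
    have := Real.sq_sqrt (show 0 ≤ a ^ 2 - 4 * b by nlinarith)
    unfold lam
    linear_combination this / 4
  have hL0 : lam a b ≠ 0 := by linarith
  refine ⟨hL, ?_, ?_, div_nonneg h2 (by linarith), div_le_self h2 hL⟩
  · unfold mu; field_simp; linarith
  · unfold mu; field_simp

/-- The coordinate `ζ_+` of the saddle `z_+`. -/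
noncomputable def zetaPlus (a b : ℝ) : ℝ := 1 - 2 * (b + 1) / (a + b + 1)

lemma fixedPoint_one : fixedPoint a b 1 = (zetaPlus a b, zetaPlus a b) := by
  simp [fixedPoint, zetaPlus]

lemma zetaPlus_mul (h : Wide a b) : zetaPlus a b * (a + b + 1) = a - b - 1 := by
  have h1 := h.a_ge
  have h2 := h.b_nonneg
  have : a + b + 1 ≠ 0 := by linarith
  unfold zetaPlus
  field_simp
  ring

lemma zetaPlus_bounds (h : Wide a b) : 3 / 10 ≤ zetaPlus a b ∧ zetaPlus a b ≤ 1 := by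
  have h1 := h.a_ge
  have h2 := h.b_nonneg
  have h3 := h.b_le
  have h4 := zetaPlus_mul h
  constructor <;> nlinarith

/-- The parameters of the lines containing `β_{k+1}`. -/
noncomputable def betaLine (a b : ℝ) (k : ℕ) : ℝ × ℝ :=
  (pullLine a b (-1))^[k] (zetaPlus a b * (1 + mu a b), -mu a b)

/-- The parameters of the lines containing `γ_{k+1}`. -/
noncomputable def gammaLine (a b : ℝ) (k : ℕ) : ℝ × ℝ := pullLine a b 1 (betaLine a b k)

lemma betaLine_succ (k : ℕ) : betaLine a b (k + 1) = pullLine a b (-1) (betaLine a b k) :=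
  Function.iterate_succ_apply' _ _ _

lemma isSteep_betaLine (h : Wide a b) (k : ℕ) : IsSteep (betaLine a b k) := by
  induction k with
  | zero =>
    obtain ⟨-, g2, g3, h4, h5⟩ := lam_spec h
    obtain ⟨z1, z2⟩ := zetaPlus_bounds h
    have h3 := h.b_le
    simp only [betaLine, Function.iterate_zero, id]
    refine ⟨by simp only; linarith, by simp only; linarith, ?_, ?_⟩
    · rintro y ⟨y1, y2⟩
      simp only [lineAt]
      nlinarith
    · rintro y ⟨y1, y2⟩
      have h6 := zetaPlus_mul h
      have h7 := h.a_ge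
      have h8 := h.b_nonneg
      have h9 : zetaPlus a b + 2 * mu a b ≤ 1 := by
        have g4 : mu a b * (a + b + 1) = b + mu a b ^ 2 + mu a b * (b + 1) := by
          linear_combination g3 - mu a b * g2
        have g5 : mu a b * (a + b + 1) ≤ b + 1 := by nlinarith
        by_contra! hc
        nlinarith
      simp only [lineAt]
      nlinarith
  | succ k ih => rw [betaLine_succ]; exact ih.pullLine h _

lemma isSteep_gammaLine (h : Wide a b) (k : ℕ) : IsSteep (gammaLine a b k) :=
  (isSteep_betaLine h k).pullLine h 1

/-- z_+ is fixed by Λ_+ and (-μ, 1) is an eigenvector of its linear part, so this line is its own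
pullback. -/
lemma gammaLine_zero (h : Wide a b) : gammaLine a b 0 = betaLine a b 0 := by
  obtain ⟨h1, h2, h3, h4, h5⟩ := lam_spec h
  have h6 := zetaPlus_mul h
  have hL : a - mu a b = lam a b := by linarith
  have hL0 : lam a b ≠ 0 := by linarith
  simp only [gammaLine, betaLine, Function.iterate_zero, id, pullLine, Units.val_one,
    Int.cast_one, one_mul, ← sub_eq_add_neg, hL]
  ext
  · simp only
    rw [div_eq_iff hL0]
    linear_combination -h6 - zetaPlus a b * (h2 + h3)
  · simp only
    rw [div_eq_iff hL0]
    linear_combination h3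

lemma lozi_stable_direction (h : Wide a b) {t : ℝ} (ht : |t| ≤ 2) :
    lozi a b (fixedPoint a b 1 + t • (-mu a b, (1 : ℝ))) =
      fixedPoint a b 1 + (-mu a b * t) • (-mu a b, (1 : ℝ)) := by
  obtain ⟨h1, h2, h3, h4, h5⟩ := lam_spec h
  obtain ⟨z1, -⟩ := zetaPlus_bounds h
  have h6 := zetaPlus_mul h
  have h7 := h.b_le
  have ht' := abs_le.1 ht
  rw [fixedPoint_one]
  have hx : 0 ≤ zetaPlus a b + t * -mu a b := by nlinarith
  have hq : mu a b ^ 2 = a * mu a b - b := by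
    linear_combination mu a b * h2 - h3
  simp only [lozi, Prod.smul_mk, Prod.mk_add_mk, smul_eq_mul, mul_one, abs_of_nonneg hx]
  ext
  · simp only
    linear_combination -h6 - t * hq
  · simp only
    ring

/-- For |t| ≤ 2 the orbit stays in x ≥ 0, where each step multiplies the displacement by -μ. -/
lemma mem_stableSet_of_direction (h : Wide a b) {t : ℝ} (ht : |t| ≤ 2) :
    fixedPoint a b 1 + t • (-mu a b, (1 : ℝ)) ∈ stableSet a b (fixedPoint a b 1) := by
  obtain ⟨-, -, -, h4, h5⟩ := lam_spec h
  have h7 := h.b_le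
  have habs : |-mu a b| < 1 := by rw [abs_neg, abs_of_nonneg h4]; linarith
  have hiter : ∀ k : ℕ, (lozi a b)^[k] (fixedPoint a b 1 + t • (-mu a b, (1 : ℝ))) =
      fixedPoint a b 1 + ((-mu a b) ^ k * t) • (-mu a b, (1 : ℝ)) := by
    intro k
    induction k with
    | zero => simp
    | succ k ih =>
      rw [Function.iterate_succ_apply', ih, lozi_stable_direction h, pow_succ]
      · congr 2; ring
      · rw [abs_mul, abs_pow]
        exact (mul_le_of_le_one_left (abs_nonneg t)
          (pow_le_one₀ (abs_nonneg _) habs.le)).trans ht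
  simp only [stableSet, mem_ofPred_eq, hiter]
  have h0 : Tendsto (fun k : ℕ => (-mu a b) ^ k * t) atTop (𝓝 0) := by
    simpa using (tendsto_pow_atTop_nhds_zero_of_abs_lt_one habs).mul_const t
  simpa using (h0.smul_const (-mu a b, (1 : ℝ))).const_add (fixedPoint a b 1)

lemma mem_betaLine_zero_iff {v : ℝ × ℝ} :
    v.1 = lineAt (betaLine a b 0) v.2 ↔
      v = fixedPoint a b 1 + (v.2 - zetaPlus a b) • (-mu a b, (1 : ℝ)) := by
  rw [fixedPoint_one]
  simp only [betaLine, Function.iterate_zero, id, lineAt, Prod.ext_iff, Prod.fst_add,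
    Prod.snd_add, Prod.smul_fst, Prod.smul_snd, smul_eq_mul]
  constructor
  · intro e
    exact ⟨by linear_combination e, by ring⟩
  · rintro ⟨e, -⟩
    linear_combination e

lemma abs_sub_zetaPlus_le (h : Wide a b) {y : ℝ} (hy : y ∈ Icc (-1 : ℝ) 1) :
    |y - zetaPlus a b| ≤ 2 := by
  obtain ⟨z1, z2⟩ := zetaPlus_bounds h
  rw [abs_le]
  constructor <;> linarith [hy.1, hy.2]

lemma vseg_betaLine_zero_subset (h : Wide a b) :
    vseg (betaLine a b 0).1 (betaLine a b 0).2 ⊆ stableSet a b (fixedPoint a b 1) := by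
  rintro v ⟨hv, e⟩
  rw [mem_betaLine_zero_iff.1 e]
  exact mem_stableSet_of_direction h (abs_sub_zetaPlus_le h hv)

lemma stableSegment_inter_strip (h : Wide a b) :
    stableSegment a b 1 ∩ strip = vseg (betaLine a b 0).1 (betaLine a b 0).2 := by
  ext v
  constructor
  · rintro ⟨⟨⟨t, ht⟩, -⟩, hv⟩
    refine ⟨hv, mem_betaLine_zero_iff.2 ?_⟩
    have h2 : v.2 - zetaPlus a b = t := by
      rw [ht, fixedPoint_one]; simp
    rw [h2, ht]
    simp
  · rintro ⟨hv, e⟩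
    have e' := mem_betaLine_zero_iff.1 e
    refine ⟨⟨⟨v.2 - zetaPlus a b, by simpa using e'⟩, ?_⟩, hv⟩
    rw [e', segment_eq_image']
    rintro _ ⟨r, hr, rfl⟩
    simp only [add_sub_cancel_left, smul_smul]
    apply mem_stableSet_of_direction h
    rw [abs_mul, abs_of_nonneg hr.1]
    exact (mul_le_of_le_one_left (abs_nonneg _) hr.2).trans (abs_sub_zetaPlus_le h hv)

lemma beta_succ (h : Wide a b) (k : ℕ) :
    beta a b (k + 1) = vseg (betaLine a b k).1 (betaLine a b k).2 := by
  unfold beta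
  rw [Nat.add_sub_cancel]
  induction k with
  | zero => exact stableSegment_inter_strip h
  | succ k ih =>
    rw [Function.iterate_succ_apply', ih, pullback_vseg (isSteep_betaLine h k) h, betaLine_succ]

lemma gamma_succ (h : Wide a b) (k : ℕ) :
    gamma a b (k + 1) = vseg (gammaLine a b k).1 (gammaLine a b k).2 := by
  rw [gamma, beta_succ h, pullback_vseg (isSteep_betaLine h k) h, gammaLine]

lemma isLow_betaLine_zero (h : Wide a b) : IsLow a b (betaLine a b 0) := by
  obtain ⟨-, -, -, h4, h5⟩ := lam_spec h
  obtain ⟨z1, z2⟩ := zetaPlus_bounds h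
  have h6 := zetaPlus_mul h
  have h1 := h.a_ge
  have h2 := h.b_nonneg
  have h3 := h.b_le
  simp only [IsLow, betaLine, Function.iterate_zero, id]
  have h7 : zetaPlus a b * 297 / 100 ≤ a - b - 1 := by nlinarith
  nlinarith

lemma lineAt_zero (p : ℝ × ℝ) : lineAt p 0 = p.1 := by simp [lineAt]

lemma isLow_betaLine (h : Wide a b) (k : ℕ) : IsLow a b (betaLine a b k) := by
  induction k with
  | zero => exact isLow_betaLine_zero h
  | succ k ih =>
    have := ih.pullLine_side (isSteep_betaLine h k) h (-1) (y := 0) (by norm_num)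
    rw [← betaLine_succ, lineAt_zero] at this
    simp only [Units.val_neg, Units.val_one, Int.cast_neg, Int.cast_one] at this
    unfold IsLow
    linarith [h.a_ge, h.b_le]

lemma betaLine_succ_neg (h : Wide a b) (k : ℕ) {y : ℝ} (hy : y ∈ Icc (-1 : ℝ) 1) :
    lineAt (betaLine a b (k + 1)) y < 0 := by
  have := (isLow_betaLine h k).pullLine_side (isSteep_betaLine h k) h (-1) hy
  rw [← betaLine_succ] at this
  simp only [Units.val_neg, Units.val_one, Int.cast_neg, Int.cast_one] at this
  linarith

lemma gammaLine_pos (h : Wide a b) (k : ℕ) {y : ℝ} (hy : y ∈ Icc (-1 : ℝ) 1) :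
    0 < lineAt (gammaLine a b k) y := by
  have := (isLow_betaLine h k).pullLine_side (isSteep_betaLine h k) h 1 hy
  simpa [gammaLine] using this

lemma betaLine_zero_pos (h : Wide a b) {y : ℝ} (hy : y ∈ Icc (-1 : ℝ) 1) :
    0 < lineAt (betaLine a b 0) y := by
  rw [← gammaLine_zero h]; exact gammaLine_pos h 0 hy

lemma leftOf_betaLine (h : Wide a b) (k : ℕ) : LeftOf (betaLine a b (k + 1)) (betaLine a b k) := by
  induction k with
  | zero => exact fun y hy => (betaLine_succ_neg h 0 hy).trans (betaLine_zero_pos h hy)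
  | succ k ih =>
    rw [betaLine_succ (k + 1)]
    nth_rw 2 [betaLine_succ k]
    exact ih.pullLine_neg (isSteep_betaLine h _) (isSteep_betaLine h _) h

lemma leftOf_gammaLine (h : Wide a b) (k : ℕ) :
    LeftOf (gammaLine a b k) (gammaLine a b (k + 1)) :=
  (leftOf_betaLine h k).pullLine_pos (isSteep_betaLine h _) (isSteep_betaLine h _) h

/-- C_2 and C_3 are bounded by γ_1, γ_2, γ_3, so this is the extreme case needed. For a > 2 + 2b
steepness suffices. Otherwise the parameters are close to a = 2, b = 0, where β_1, β_2, β_3, γ_3 lie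
at 1/3, -1/3, -2/3, 5/6, and 5/6 < a - 1 = 1. -/
lemma isLow_gammaLine_two (h : Wide a b) : IsLow a b (gammaLine a b 2) := by
  have h1 := h.a_ge
  have h2 := h.b_nonneg
  have h3 := h.b_le
  rcases lt_or_ge (2 + 2 * b) a with ha | ha
  · have := (isSteep_gammaLine h 2).le 0 (by norm_num)
    rw [lineAt_zero] at this
    unfold IsLow
    linarith
  · have s0 := isSteep_betaLine h 0
    have s1 := isSteep_betaLine h 1
    have s2 := isSteep_betaLine h 2
    have q1 := abs_le.1 (pullLine_slope s0 h (-1))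
    have q2 := abs_le.1 (pullLine_slope s1 h (-1))
    rw [← betaLine_succ] at q1 q2
    obtain ⟨z1, z2⟩ := zetaPlus_bounds h
    obtain ⟨-, -, -, h4, h5⟩ := lam_spec h
    have c0 : 3 / 10 ≤ (betaLine a b 0).1 := by
      simp only [betaLine, Function.iterate_zero, id]; nlinarith
    have c0' : -(1 / 10000) ≤ (betaLine a b 0).2 ∧ (betaLine a b 0).2 ≤ 1 / 10000 := by
      simp only [betaLine, Function.iterate_zero, id]; constructor <;> linarith
    have e1 : (betaLine a b 1).1 * (a - (betaLine a b 0).2) =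
        (betaLine a b 0).1 - (a - b - 1) := by
      rw [betaLine_succ]
      simp only [pullLine, Units.val_neg, Units.val_one, Int.cast_neg, Int.cast_one]
      have : -1 * a + (betaLine a b 0).2 ≠ 0 := by linarith
      rw [div_mul_eq_mul_div, div_eq_iff this]
      ring
    have e2 : (betaLine a b 2).1 * (a - (betaLine a b 1).2) =
        (betaLine a b 1).1 - (a - b - 1) := by
      rw [betaLine_succ]
      simp only [pullLine, Units.val_neg, Units.val_one, Int.cast_neg, Int.cast_one]
      have : -1 * a + (betaLine a b 1).2 ≠ 0 := by linarith
      rw [div_mul_eq_mul_div, div_eq_iff this]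
      ring
    have e3 : (gammaLine a b 2).1 * (a + (betaLine a b 2).2) =
        (a - b - 1) - (betaLine a b 2).1 := by
      simp only [gammaLine, pullLine, Units.val_one, Int.cast_one]
      have : 1 * a + (betaLine a b 2).2 ≠ 0 := by linarith
      rw [div_mul_eq_mul_div, div_eq_iff this]
      ring
    have f1 : -(38 / 100) ≤ (betaLine a b 1).1 := by
      by_contra! hc
      nlinarith
    have f2 : -(71 / 100) ≤ (betaLine a b 2).1 := by
      by_contra! hc
      nlinarith
    have f3 : (gammaLine a b 2).1 ≤ 88 / 100 := by
      by_contra! hc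
      nlinarith
    unfold IsLow
    linarith

lemma isLow_gammaLine (h : Wide a b) {k : ℕ} (hk : k ≤ 2) : IsLow a b (gammaLine a b k) := by
  have h2 := isLow_gammaLine_two h
  have l1 := leftOf_gammaLine h 0 0 (by norm_num)
  have l2 := leftOf_gammaLine h 1 0 (by norm_num)
  rw [lineAt_zero, lineAt_zero] at l1 l2
  unfold IsLow at *
  interval_cases k <;> norm_num at * <;> linarith

lemma vseg_betaLine_subset (h : Wide a b) (k : ℕ) :
    vseg (betaLine a b k).1 (betaLine a b k).2 ⊆ stableSet a b (fixedPoint a b 1) := by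
  induction k with
  | zero => exact vseg_betaLine_zero_subset h
  | succ k ih =>
    rw [betaLine_succ]
    exact vseg_pullLine_subset_stableSet (isLow_betaLine h k) (isSteep_betaLine h k) h _ ih

lemma vseg_gammaLine_subset (h : Wide a b) (k : ℕ) :
    vseg (gammaLine a b k).1 (gammaLine a b k).2 ⊆ stableSet a b (fixedPoint a b 1) :=
  vseg_pullLine_subset_stableSet (isLow_betaLine h k) (isSteep_betaLine h k) h _
    (vseg_betaLine_subset h k)

end

/-! ## The splitting of `C_{m,n}` -/

section

variable {a b : ℝ} {p q v : ℝ × ℝ}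

lemma IsSteep.iterate_neg (hp : IsSteep p) (h : Wide a b) (k : ℕ) :
    IsSteep ((Lozi.pullLine a b (-1))^[k] p) := by
  induction k with
  | zero => exact hp
  | succ k ih => rw [Function.iterate_succ_apply']; exact ih.pullLine h _

lemma exists_lineFn_iterate_neg (hp : IsSteep p) (h : Wide a b) (k : ℕ) (v : ℝ × ℝ) :
    ∃ K : ℝ, 0 < K ∧ lineFn p ((branch a b (-1))^[k] v) =
      K * lineFn ((pullLine a b (-1))^[k] p) v := by
  induction k generalizing v with
  | zero => exact ⟨1, one_pos, by simp⟩
  | succ k ih =>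
    obtain ⟨K, hK, e⟩ := ih (branch a b (-1) v)
    have hs := hp.iterate_neg h k
    refine ⟨K * (a - ((pullLine a b (-1))^[k] p).2), mul_pos hK ?_, ?_⟩
    · linarith [hs.slope_le, h.a_ge]
    · rw [Function.iterate_succ_apply, e, lineFn_branch_neg hs h, Function.iterate_succ_apply']
      ring

/-- The first `k + 1` steps `Λ_-^k ∘ Λ_+` along the itinerary of `C_{k+2}`. -/
noncomputable def descent (a b : ℝ) (k : ℕ) (v : ℝ × ℝ) : ℝ × ℝ :=
  (branch a b (-1))^[k] (branch a b 1 v)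

/-- The pullback of a line along `Λ_-^k ∘ Λ_+`. -/
noncomputable def descentLine (a b : ℝ) (k : ℕ) (p : ℝ × ℝ) : ℝ × ℝ :=
  pullLine a b 1 ((pullLine a b (-1))^[k] p)

lemma exists_lineFn_descent (hp : IsSteep p) (h : Wide a b) (k : ℕ) (v : ℝ × ℝ) :
    ∃ K : ℝ, 0 < K ∧ lineFn p (descent a b k v) = -(K * lineFn (descentLine a b k p) v) := by
  obtain ⟨K, hK, e⟩ := exists_lineFn_iterate_neg hp h k (branch a b 1 v)
  have hs := hp.iterate_neg h k
  refine ⟨K * (a + ((pullLine a b (-1))^[k] p).2), mul_pos hK ?_, ?_⟩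
  · linarith [hs.slope_ge, h.a_ge]
  · rw [descent, e, lineFn_branch_pos hs h, descentLine]
    ring

lemma lineFn_descentLine_nonneg_iff (hp : IsSteep p) (h : Wide a b) (k : ℕ) :
    0 ≤ lineFn (descentLine a b k p) v ↔ lineFn p (descent a b k v) ≤ 0 := by
  obtain ⟨K, hK, e⟩ := exists_lineFn_descent hp h k v
  rw [e, neg_nonpos, mul_nonneg_iff_of_pos_left hK]

lemma lineFn_descentLine_nonpos_iff (hp : IsSteep p) (h : Wide a b) (k : ℕ) :
    lineFn (descentLine a b k p) v ≤ 0 ↔ 0 ≤ lineFn p (descent a b k v) := by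
  obtain ⟨K, hK, e⟩ := exists_lineFn_descent hp h k v
  rw [e, le_neg, neg_zero]
  constructor
  · exact fun hx => mul_nonpos_of_nonneg_of_nonpos hK.le hx
  · intro hx
    by_contra! hc
    linarith [mul_pos hK hc]

lemma LeftOf.iterate_neg (hpq : LeftOf p q) (hp : IsSteep p) (hq : IsSteep q) (h : Wide a b)
    (k : ℕ) : LeftOf ((pullLine a b (-1))^[k] p) ((pullLine a b (-1))^[k] q) := by
  induction k with
  | zero => exact hpq
  | succ k ih =>
    rw [Function.iterate_succ_apply', Function.iterate_succ_apply']
    exact ih.pullLine_neg (hp.iterate_neg h k) (hq.iterate_neg h k) h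

lemma LeftOf.descentLine (hpq : LeftOf p q) (hp : IsSteep p) (hq : IsSteep q) (h : Wide a b)
    (k : ℕ) : LeftOf (descentLine a b k q) (descentLine a b k p) :=
  (hpq.iterate_neg hp hq h k).pullLine_pos (hp.iterate_neg h k) (hq.iterate_neg h k) h

lemma betaLine_add (k j : ℕ) :
    betaLine a b (k + j) = (pullLine a b (-1))^[k] (betaLine a b j) :=
  Function.iterate_add_apply _ _ _ _

lemma gammaLine_eq_descentLine (k j : ℕ) :
    gammaLine a b (k + j) = descentLine a b k (betaLine a b j) := by
  rw [gammaLine, betaLine_add, descentLine]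

/-- Points between `β_{k+2}` and `β_{k+1}` follow the left branch for `k` steps. -/
lemma lozi_iterate_between (h : Wide a b) (k : ℕ) (hv : v ∈ strip)
    (h1 : 0 ≤ lineFn (betaLine a b (k + 1)) v) (h2 : lineFn (betaLine a b k) v ≤ 0) :
    (lozi a b)^[k] v = (branch a b (-1))^[k] v ∧ (branch a b (-1))^[k] v ∈ strip := by
  induction k generalizing v with
  | zero => exact ⟨rfl, hv⟩
  | succ k ih =>
    have e1 : lineAt (betaLine a b (k + 2)) v.2 ≤ v.1 := sub_nonneg.1 h1
    have e2 : v.1 ≤ lineAt (betaLine a b (k + 1)) v.2 := sub_nonpos.1 h2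
    have e3 := betaLine_succ_neg h k hv
    have e4 := (isSteep_betaLine h (k + 2)).ge _ hv
    have s1 := isSteep_betaLine h (k + 1)
    have s0 := isSteep_betaLine h k
    have ha := h.a_ge
    have hl : lozi a b v = branch a b (-1) v := lozi_eq_branch a b (by
      simp only [Units.val_neg, Units.val_one, Int.cast_neg, Int.cast_one]; linarith)
    rw [Function.iterate_succ_apply, Function.iterate_succ_apply, hl]
    refine ih (branch_mem_strip (by linarith) (by linarith)) ?_ ?_
    · rw [lineFn_branch_neg s1 h, ← betaLine_succ]
      exact mul_nonneg (by linarith [s1.slope_le]) h1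
    · rw [lineFn_branch_neg s0 h, ← betaLine_succ]
      exact mul_nonpos_of_nonneg_of_nonpos (by linarith [s0.slope_le]) h2

lemma mem_setC_iff (h : Wide a b) (k : ℕ) :
    v ∈ setC a b (k + 2) ↔
      v ∈ strip ∧ 0 ≤ lineFn (gammaLine a b k) v ∧ lineFn (gammaLine a b (k + 1)) v ≤ 0 := by
  rw [setC, show k + 2 - 1 = k + 1 from rfl, gamma_succ h, show k + 2 = (k + 1) + 1 from rfl,
    gamma_succ h]
  exact mem_vstrip_iff (leftOf_gammaLine h k)

lemma lozi_iterate_setC (h : Wide a b) (k : ℕ) (hv : v ∈ setC a b (k + 2)) :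
    (lozi a b)^[k + 1] v = descent a b k v ∧ descent a b k v ∈ strip := by
  obtain ⟨hs, h1, h2⟩ := (mem_setC_iff h k).1 hv
  have e1 : lineAt (gammaLine a b k) v.2 ≤ v.1 := sub_nonneg.1 h1
  have e2 : v.1 ≤ lineAt (gammaLine a b (k + 1)) v.2 := sub_nonpos.1 h2
  have e3 := gammaLine_pos h k hs
  have e4 := (isSteep_gammaLine h (k + 1)).le _ hs
  have s1 := isSteep_betaLine h (k + 1)
  have s0 := isSteep_betaLine h k
  have ha := h.a_ge
  have hl : lozi a b v = branch a b 1 v := lozi_eq_branch a b (by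
    simp only [Units.val_one, Int.cast_one]; linarith)
  rw [Function.iterate_succ_apply, hl]
  refine lozi_iterate_between h k (branch_mem_strip (by linarith) (by linarith)) ?_ ?_
  · rw [lineFn_branch_pos s1 h]
    exact mul_nonneg_of_nonpos_of_nonpos (by linarith [s1.slope_ge]) h2
  · rw [lineFn_branch_pos s0 h]
    exact mul_nonpos_of_nonpos_of_nonneg (by linarith [s0.slope_ge]) h1

lemma mem_setCC_iff (m n : ℕ) :
    v ∈ setCC a b m n ↔ v ∈ setC a b m ∧ (lozi a b)^[m] v ∈ setC a b n :=
  ⟨fun hv => ⟨hv.1, hv.2.2⟩, fun hv => ⟨hv.1, ⟨v, hv.1, rfl⟩, hv.2⟩⟩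

/-- The four lines bounding the components of `C_{k+2,j+2}`, as seen at time `k + 1`. -/
noncomputable def cutLine (a b : ℝ) (j : ℕ) : Fin 4 → ℝ × ℝ :=
  ![pullLine a b 1 (gammaLine a b j), pullLine a b 1 (gammaLine a b (j + 1)),
    pullLine a b (-1) (gammaLine a b (j + 1)), pullLine a b (-1) (gammaLine a b j)]

lemma isSteep_cutLine (h : Wide a b) (j : ℕ) (i : Fin 4) : IsSteep (cutLine a b j i) := by
  fin_cases i <;> exact (isSteep_gammaLine h _).pullLine h _

lemma cutLine_pos (h : Wide a b) {j : ℕ} (hj : j ≤ 1) {y : ℝ} (hy : y ∈ Icc (-1 : ℝ) 1) :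
    0 < lineAt (cutLine a b j 1) y := by
  simpa [cutLine] using (isLow_gammaLine h (k := j + 1) (by omega)).pullLine_side
    (isSteep_gammaLine h _) h 1 hy

lemma cutLine_neg (h : Wide a b) {j : ℕ} (hj : j ≤ 1) {y : ℝ} (hy : y ∈ Icc (-1 : ℝ) 1) :
    lineAt (cutLine a b j 2) y < 0 := by
  simpa [cutLine] using (isLow_gammaLine h (k := j + 1) (by omega)).pullLine_side
    (isSteep_gammaLine h _) h (-1) hy

/-- At time k + 1 the cut lines are numbered from right to left, since the descent reverses their
order. The middle gap contains x = 0 because the γ lines are low. -/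
lemma leftOf_cutLine (h : Wide a b) {j : ℕ} (hj : j ≤ 1) (i : Fin 3) :
    LeftOf (cutLine a b j i.succ) (cutLine a b j i.castSucc) := by
  fin_cases i
  · exact (leftOf_gammaLine h j).pullLine_pos (isSteep_gammaLine h _) (isSteep_gammaLine h _) h
  · exact fun y hy => (cutLine_neg h hj hy).trans (cutLine_pos h hj hy)
  · exact (leftOf_gammaLine h j).pullLine_neg (isSteep_gammaLine h _) (isSteep_gammaLine h _) h

lemma cutLine_subset (h : Wide a b) {j : ℕ} (hj : j ≤ 1) (i : Fin 4) :
    vseg (cutLine a b j i).1 (cutLine a b j i).2 ⊆ stableSet a b (fixedPoint a b 1) := by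
  fin_cases i <;> exact vseg_pullLine_subset_stableSet (isLow_gammaLine h (by omega))
    (isSteep_gammaLine h _) h _ (vseg_gammaLine_subset h _)

lemma IsLow.pullLine_neg (hl : IsLow a b p) (hp : IsSteep p) (h : Wide a b) :
    IsLow a b (pullLine a b (-1) p) := by
  have := hl.pullLine_side hp h (-1) (y := 0) (by norm_num)
  rw [lineAt_zero] at this
  simp only [Units.val_neg, Units.val_one, Int.cast_neg, Int.cast_one] at this
  unfold IsLow
  linarith [h.a_ge, h.b_le]

lemma isLow_pullLine_pos (hp : IsSteep p) (h : Wide a b) (h0 : 0 ≤ p.1) :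
    IsLow a b (pullLine a b 1 p) := by
  have h1 := h.a_ge
  have h2 := h.b_le
  have h3 := h.b_nonneg
  have h4 := hp.slope_ge
  simp only [IsLow, pullLine, Units.val_one, Int.cast_one, one_mul]
  rw [div_lt_iff₀ (by linarith)]
  nlinarith

lemma gammaLine_fst_pos (h : Wide a b) (k : ℕ) : 0 < (gammaLine a b k).1 := by
  simpa [lineAt_zero] using gammaLine_pos h k (y := 0) (by norm_num)

lemma isLow_cutLine (h : Wide a b) {j : ℕ} (hj : j ≤ 1) (i : Fin 4) :
    IsLow a b (cutLine a b j i) := by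
  fin_cases i
  · exact isLow_pullLine_pos (isSteep_gammaLine h _) h (gammaLine_fst_pos h _).le
  · exact isLow_pullLine_pos (isSteep_gammaLine h _) h (gammaLine_fst_pos h _).le
  · exact (isLow_gammaLine h (by omega)).pullLine_neg (isSteep_gammaLine h _) h
  · exact (isLow_gammaLine h (by omega)).pullLine_neg (isSteep_gammaLine h _) h

lemma vseg_descentLine_subset (hl : IsLow a b p) (hp : IsSteep p) (h : Wide a b) (k : ℕ)
    {z : ℝ × ℝ} (hs : vseg p.1 p.2 ⊆ stableSet a b z) :
    vseg (descentLine a b k p).1 (descentLine a b k p).2 ⊆ stableSet a b z := by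
  have key : IsLow a b ((pullLine a b (-1))^[k] p) ∧
      vseg ((pullLine a b (-1))^[k] p).1 ((pullLine a b (-1))^[k] p).2 ⊆ stableSet a b z := by
    induction k with
    | zero => exact ⟨hl, hs⟩
    | succ k ih =>
      rw [Function.iterate_succ_apply']
      exact ⟨ih.1.pullLine_neg (hp.iterate_neg h k) h,
        vseg_pullLine_subset_stableSet ih.1 (hp.iterate_neg h k) h _ ih.2⟩
  exact vseg_pullLine_subset_stableSet key.1 (hp.iterate_neg h k) h _ key.2

/-- As γ_1 = β_1 is its own pullback under Λ_+, γ_{k+1} is the descent pullback of Π_+(γ_1). For j =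
1 two orientation reversals turn γ_1 lying left of γ_2 into the inequality. -/
lemma gammaLine_le_descentLine (h : Wide a b) {j : ℕ} (hj : j ≤ 1) (k : ℕ) {y : ℝ}
    (hy : y ∈ Icc (-1 : ℝ) 1) :
    lineAt (gammaLine a b k) y ≤ lineAt (descentLine a b k (cutLine a b j 0)) y := by
  have e : gammaLine a b k = descentLine a b k (pullLine a b 1 (gammaLine a b 0)) := by
    rw [gammaLine_zero h]
    change _ = descentLine a b k (gammaLine a b 0)
    rw [gammaLine_zero h]
    exact gammaLine_eq_descentLine k 0
  rw [e]
  interval_cases j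
  · exact le_rfl
  · exact (((leftOf_gammaLine h 0).pullLine_pos (isSteep_gammaLine h _) (isSteep_gammaLine h _)
      h).descentLine ((isSteep_gammaLine h _).pullLine h _)
      ((isSteep_gammaLine h _).pullLine h _) h k y hy).le

lemma descentLine_le_gammaLine (h : Wide a b) {j : ℕ} (hj : j ≤ 1) (k : ℕ) {y : ℝ}
    (hy : y ∈ Icc (-1 : ℝ) 1) :
    lineAt (descentLine a b k (cutLine a b j 3)) y ≤ lineAt (gammaLine a b (k + 1)) y := by
  have e : gammaLine a b (k + 1) = descentLine a b k (pullLine a b (-1) (gammaLine a b 0)) := by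
    rw [gammaLine_zero h, ← betaLine_succ]
    exact gammaLine_eq_descentLine k 1
  rw [e]
  interval_cases j
  · exact le_rfl
  · exact (((leftOf_gammaLine h 0).pullLine_neg (isSteep_gammaLine h _) (isSteep_gammaLine h _)
      h).descentLine ((isSteep_gammaLine h _).pullLine h _)
      ((isSteep_gammaLine h _).pullLine h _) h k y hy).le

lemma branch_mem_between_iff (hp : IsSteep p) (hq : IsSteep q) (h : Wide a b) :
    (0 ≤ lineFn p (branch a b 1 v) ∧ lineFn q (branch a b 1 v) ≤ 0 ↔
      lineFn (pullLine a b 1 p) v ≤ 0 ∧ 0 ≤ lineFn (pullLine a b 1 q) v) := by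
  have h1 := lineFn_descentLine_nonpos_iff (v := v) hp h 0
  have h2 := lineFn_descentLine_nonneg_iff (v := v) hq h 0
  exact and_congr h1.symm h2.symm

lemma branch_neg_mem_between_iff (hp : IsSteep p) (hq : IsSteep q) (h : Wide a b) :
    (0 ≤ lineFn p (branch a b (-1) v) ∧ lineFn q (branch a b (-1) v) ≤ 0 ↔
      0 ≤ lineFn (pullLine a b (-1) p) v ∧ lineFn (pullLine a b (-1) q) v ≤ 0) := by
  have h1 := h.a_ge
  rw [lineFn_branch_neg hp h, lineFn_branch_neg hq h,
    mul_nonneg_iff_of_pos_left (by linarith [hp.slope_le]),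
    mul_nonpos_iff_pos_imp_nonpos]
  have h2 : 0 < a - q.2 := by linarith [hq.slope_le]
  constructor
  · rintro ⟨e1, e2, -⟩
    exact ⟨e1, e2 h2⟩
  · rintro ⟨e1, e2⟩
    exact ⟨e1, fun _ => e2, fun _ => h2.le⟩

/-- The bounding lines of the components of `C_{k+2,j+2}`, from left to right. -/
noncomputable def splitLine (a b : ℝ) (k j : ℕ) (i : Fin 4) : ℝ × ℝ :=
  descentLine a b k (cutLine a b j i)

lemma leftOf_splitLine (h : Wide a b) {j : ℕ} (hj : j ≤ 1) (k : ℕ) (i : Fin 3) :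
    LeftOf (splitLine a b k j i.castSucc) (splitLine a b k j i.succ) :=
  (leftOf_cutLine h hj i).descentLine (isSteep_cutLine h _ _) (isSteep_cutLine h _ _) h k

/-- The strip between two consecutive bounding lines. -/
noncomputable def splitStrip (a b : ℝ) (k j : ℕ) (i i' : Fin 4) : Set (ℝ × ℝ) :=
  vstrip (vseg (splitLine a b k j i).1 (splitLine a b k j i).2)
    (vseg (splitLine a b k j i').1 (splitLine a b k j i').2)

lemma mem_splitStrip_left_iff (h : Wide a b) {j : ℕ} (hj : j ≤ 1) (k : ℕ) :
    v ∈ splitStrip a b k j 0 1 ↔ v ∈ strip ∧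
      lineFn (cutLine a b j 0) (descent a b k v) ≤ 0 ∧
      0 ≤ lineFn (cutLine a b j 1) (descent a b k v) := by
  rw [splitStrip, mem_vstrip_iff (show LeftOf (splitLine a b k j 0) (splitLine a b k j 1) from
    leftOf_splitLine h hj k 0), splitLine, splitLine,
    lineFn_descentLine_nonneg_iff (isSteep_cutLine h _ _) h,
    lineFn_descentLine_nonpos_iff (isSteep_cutLine h _ _) h]

lemma mem_splitStrip_right_iff (h : Wide a b) {j : ℕ} (hj : j ≤ 1) (k : ℕ) :
    v ∈ splitStrip a b k j 2 3 ↔ v ∈ strip ∧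
      lineFn (cutLine a b j 2) (descent a b k v) ≤ 0 ∧
      0 ≤ lineFn (cutLine a b j 3) (descent a b k v) := by
  rw [splitStrip, mem_vstrip_iff (show LeftOf (splitLine a b k j 2) (splitLine a b k j 3) from
    leftOf_splitLine h hj k 2), splitLine, splitLine,
    lineFn_descentLine_nonneg_iff (isSteep_cutLine h _ _) h,
    lineFn_descentLine_nonpos_iff (isSteep_cutLine h _ _) h]

lemma splitStrip_subset_setC (h : Wide a b) {j : ℕ} (hj : j ≤ 1) (k : ℕ) {i i' : Fin 4}
    (hii : LeftOf (splitLine a b k j i) (splitLine a b k j i')) :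
    splitStrip a b k j i i' ⊆ setC a b (k + 2) := by
  intro v hv
  obtain ⟨hs, h1, h2⟩ := (mem_vstrip_iff hii).1 hv
  have hmono : StrictMono fun i => lineAt (splitLine a b k j i) v.2 :=
    Fin.strictMono_iff_lt_succ.2 fun i => leftOf_splitLine h hj k i v.2 hs
  have e0 := gammaLine_le_descentLine h hj k hs
  have e3 := descentLine_le_gammaLine h hj k hs
  have l0 : lineAt (splitLine a b k j 0) v.2 ≤ lineAt (splitLine a b k j i) v.2 :=
    hmono.monotone (Fin.zero_le i)
  have l3 : lineAt (splitLine a b k j i') v.2 ≤ lineAt (splitLine a b k j 3) v.2 :=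
    hmono.monotone (Fin.le_last i')
  refine (mem_setC_iff h k).2 ⟨hs, ?_, ?_⟩
  · unfold lineFn at *
    unfold splitLine at *
    linarith
  · unfold lineFn at *
    unfold splitLine at *
    linarith

/-- On C_m the first m - 1 steps follow fixed affine branches; in the last step the sign of x
decides through which branch C_n is pulled back. The sign + gives the left strip. -/
lemma setCC_eq (h : Wide a b) {j : ℕ} (hj : j ≤ 1) (k : ℕ) :
    setCC a b (k + 2) (j + 2) = splitStrip a b k j 0 1 ∪ splitStrip a b k j 2 3 := by
  have g0 := isSteep_gammaLine h j
  have g1 := isSteep_gammaLine h (j + 1)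
  ext v
  rw [mem_union, mem_setCC_iff]
  constructor
  · rintro ⟨hC, hC'⟩
    obtain ⟨e, hw⟩ := lozi_iterate_setC h k hC
    rw [Function.iterate_succ_apply', e, mem_setC_iff h] at hC'
    have hs := ((mem_setC_iff h k).1 hC).1
    rcases le_total 0 (descent a b k v).1 with h0 | h0
    · left
      rw [lozi_eq_branch a b (σ := 1) (by simpa using h0)] at hC'
      exact (mem_splitStrip_left_iff h hj k).2 ⟨hs, (branch_mem_between_iff g0 g1 h).1 hC'.2⟩
    · right
      rw [lozi_eq_branch a b (σ := -1) (by simpa using h0)] at hC'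
      exact (mem_splitStrip_right_iff h hj k).2
        ⟨hs, ((branch_neg_mem_between_iff g0 g1 h).1 hC'.2).symm⟩
  · rintro (hv | hv)
    · have hC := splitStrip_subset_setC h hj k (leftOf_splitLine h hj k 0) hv
      obtain ⟨e, hw⟩ := lozi_iterate_setC h k hC
      obtain ⟨hs, h1, h2⟩ := (mem_splitStrip_left_iff h hj k).1 hv
      have p1 := cutLine_pos h hj hw
      have p2 := (isSteep_cutLine h j 0).le _ hw
      have p3 := sub_nonpos.1 h1
      have p4 := sub_nonneg.1 h2
      refine ⟨hC, ?_⟩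
      rw [Function.iterate_succ_apply', e, mem_setC_iff h,
        lozi_eq_branch a b (σ := 1) (by simp; linarith)]
      exact ⟨branch_mem_strip (by linarith) (by linarith),
        (branch_mem_between_iff g0 g1 h).2 ⟨h1, h2⟩⟩
    · have hC := splitStrip_subset_setC h hj k (leftOf_splitLine h hj k 2) hv
      obtain ⟨e, hw⟩ := lozi_iterate_setC h k hC
      obtain ⟨hs, h1, h2⟩ := (mem_splitStrip_right_iff h hj k).1 hv
      have p1 := cutLine_neg h hj hw
      have p2 := (isSteep_cutLine h j 3).ge _ hw
      have p3 := sub_nonpos.1 h1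
      have p4 := sub_nonneg.1 h2
      refine ⟨hC, ?_⟩
      rw [Function.iterate_succ_apply', e, mem_setC_iff h,
        lozi_eq_branch a b (σ := -1) (by simp; linarith)]
      exact ⟨branch_mem_strip (by linarith) (by linarith),
        (branch_neg_mem_between_iff g0 g1 h).2 ⟨h2, h1⟩⟩

lemma isSplitting_splitStrip (h : Wide a b) {j : ℕ} (hj : j ≤ 1) (k : ℕ) :
    IsSplitting a b (k + 2) (j + 2) (splitStrip a b k j 0 1) (splitStrip a b k j 2 3) := by
  refine ⟨fun i => (splitLine a b k j i).1, fun i => (splitLine a b k j i).2, fun i => ?_,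
    fun y hy => ?_, rfl, rfl, setCC_eq h hj k⟩
  · exact vseg_descentLine_subset (isLow_cutLine h hj i) (isSteep_cutLine h j i) h k
      (cutLine_subset h hj i)
  · exact Fin.strictMono_iff_lt_succ.2 fun i => leftOf_splitLine h hj k i y hy

end

/-! ### Admissible formal orbits lie in the left component -/

section

variable {a b : ℝ} {m n : ℕ} {s z : ℕ → ℝ}

/-- The `i`-th point of the orbit with coordinate sequence `z`. -/
def orbitPoint (z : ℕ → ℝ) (i : ℕ) : ℝ × ℝ := (z (i + 1), z i)

lemma IsCyclicSolution.orbitPoint_succ {N : ℕ} (h : IsCyclicSolution a b s N z) {σ : ℤˣ} {i : ℕ}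
    (hi : s i = ((σ : ℤ) : ℝ)) : orbitPoint z (i + 1) = branch a b σ (orbitPoint z i) := by
  simp only [orbitPoint, branch, ← hi, ← h.rec_eq i]

lemma IsCyclicSolution.orbitPoint_add {N : ℕ} (h : IsCyclicSolution a b s N z) {i : ℕ} (j : ℕ)
    (hi : ∀ l, i ≤ l → l < i + j → s l = -1) :
    orbitPoint z (i + j) = (branch a b (-1))^[j] (orbitPoint z i) := by
  induction j with
  | zero => rfl
  | succ j ih =>
    rw [Function.iterate_succ_apply', ← ih fun l h1 h2 => hi l h1 (by omega), ← add_assoc]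
    exact h.orbitPoint_succ (by rw [hi (i + j) (by omega) (by omega)]; simp)

/-- The signs alone place the orbit. The left symbol at time 1 puts the initial point to the right
of β_1, hence the point at time m + n - 1 between β_2 and β_1. Pulling back along the final left
block and the two middle symbols + gives C_n at time m, and then the strip between the two right cut
lines at time m - 1. -/
lemma mem_leftComponent {σ : ℤˣ} (h : IsIotaSolution a b m n ((σ : ℤ) : ℝ) s z) (hW : Wide a b)
    (hm : 3 ≤ m) (hadm : ∀ k < m + n, 0 ≤ s k * z (k + 1)) :
    orbitPoint z 0 ∈ leftComponent a b m n := by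
  obtain ⟨k, rfl⟩ : ∃ k, m = k + 2 := ⟨m - 2, by omega⟩
  obtain ⟨j, rfl⟩ : ∃ j, n = j + 2 := ⟨n - 2, by have := h.n_eq; omega⟩
  have hj : j ≤ 1 := by have := h.n_eq; omega
  have ha := hW.a_ge
  have hbd : ∀ i, i ≤ k + 2 + (j + 2) → orbitPoint z i ∈ strip := fun i hi =>
    abs_le.1 (h.abs_le_one hW.b_nonneg (by linarith [hW.b_le]) (by omega))
  have b0 := isSteep_betaLine hW 0
  have g0 := gammaLine_zero hW
  have s0 : s 0 = ((1 : ℤˣ) : ℤ) := by rw [h.signs.first]; simp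
  have s1 : s (k + 1) = ((1 : ℤˣ) : ℤ) := by
    have := h.signs.mid_zero
    rw [show k + 2 - 1 = k + 1 from rfl] at this
    rw [this]; simp
  have s2 : s (k + 2) = ((1 : ℤˣ) : ℤ) := by rw [h.signs.mid_one]; simp
  have hlast : s (k + j + 3) = ((σ : ℤ) : ℝ) := by
    rw [← h.signs.last]; congr 1; omega
  have hN : orbitPoint z (k + j + 4) = orbitPoint z 0 := by
    have e1 := h.cyclic.per_zero
    have e2 := h.cyclic.per_one
    rw [show k + 2 + (j + 2) = k + j + 4 by omega] at e1 e2
    simp only [orbitPoint, e1, e2]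
  have o1 := h.cyclic.orbitPoint_succ s0
  have oN := h.cyclic.orbitPoint_succ hlast
  rw [show k + j + 3 + 1 = k + j + 4 by omega, hN] at oN
  have slope := b0.slope_ge
  have slope' := b0.slope_le
  have t0 : 0 ≤ lineFn (betaLine a b 0) (orbitPoint z 0) := by
    have x1 := hadm 1 (by omega)
    rw [h.signs.left 0 (by omega)] at x1
    have q := betaLine_zero_pos hW (hbd 1 (by omega))
    have e := lineFn_branch_pos b0 hW (orbitPoint z 0)
    rw [← o1] at e
    change _ = -(a + _) * lineFn (gammaLine a b 0) _ at e
    rw [g0] at e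
    have : lineFn (betaLine a b 0) (orbitPoint z 1) < 0 := by
      simp only [lineFn, orbitPoint] at q ⊢
      linarith
    by_contra! hc
    nlinarith
  -- For either σ one inequality is the sign condition, as β_2 lies in x < 0 and β_1 in x > 0; the
  -- other pulls `t0` back by Λ_σ. Equality x = 0 is allowed.
  have tN : lineFn (betaLine a b 0) (orbitPoint z (k + j + 3)) ≤ 0 ∧
      0 ≤ lineFn (betaLine a b 1) (orbitPoint z (k + j + 3)) := by
    have x := hadm (k + j + 3) (by omega)
    rw [hlast] at x
    have q0 := betaLine_zero_pos hW (hbd (k + j + 3) (by omega))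
    have q1 := betaLine_succ_neg hW 0 (hbd (k + j + 3) (by omega))
    rcases Int.units_eq_one_or σ with rfl | rfl
    · simp only [Units.val_one, Int.cast_one, one_mul] at x
      constructor
      · have e := lineFn_branch_pos b0 hW (orbitPoint z (k + j + 3))
        rw [← oN] at e
        change _ = -(a + _) * lineFn (gammaLine a b 0) _ at e
        rw [g0] at e
        by_contra! hc
        nlinarith
      · simp only [lineFn, orbitPoint] at q1 ⊢
        linarith
    · simp only [Units.val_neg, Units.val_one, Int.cast_neg, Int.cast_one] at x
      constructor
      · simp only [lineFn, orbitPoint] at q0 ⊢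
        linarith
      · have e := lineFn_branch_neg b0 hW (orbitPoint z (k + j + 3))
        rw [← oN, ← betaLine_succ] at e
        by_contra! hc
        rw [zero_add] at e
        nlinarith
  have o3 := h.cyclic.orbitPoint_add (i := k + 3) j fun l h1 h2 =>
    h.signs.right l (by omega) (by omega)
  rw [show k + 3 + j = k + j + 3 by omega] at o3
  obtain ⟨K, hK, eK⟩ := exists_lineFn_iterate_neg b0 hW j (orbitPoint z (k + 3))
  obtain ⟨K', hK', eK'⟩ := exists_lineFn_iterate_neg (isSteep_betaLine hW 1) hW j
    (orbitPoint z (k + 3))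
  rw [← betaLine_add, ← o3] at eK eK'
  have t3 : lineFn (betaLine a b j) (orbitPoint z (k + 3)) ≤ 0 ∧
      0 ≤ lineFn (betaLine a b (j + 1)) (orbitPoint z (k + 3)) := by
    rw [add_zero] at eK
    constructor
    · by_contra! hc
      linarith [tN.1, mul_pos hK hc]
    · by_contra! hc
      linarith [tN.2, mul_neg_of_pos_of_neg hK' hc]
  have o2 := h.cyclic.orbitPoint_succ s2
  have o2' := h.cyclic.orbitPoint_succ s1
  rw [o2] at t3
  have t2 := (branch_mem_between_iff (v := orbitPoint z (k + 2)) (isSteep_betaLine hW (j + 1))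
    (isSteep_betaLine hW j) hW).1 t3.symm
  change lineFn (gammaLine a b (j + 1)) _ ≤ 0 ∧ 0 ≤ lineFn (gammaLine a b j) _ at t2
  rw [show k + 2 = k + 1 + 1 from rfl, o2'] at t2
  have t1 := (branch_mem_between_iff (isSteep_gammaLine hW j) (isSteep_gammaLine hW (j + 1))
    hW).1 t2.symm
  have o1' : orbitPoint z (k + 1) = descent a b k (orbitPoint z 0) := by
    have := h.cyclic.orbitPoint_add (i := 1) k fun l h1 h2 => by
      obtain ⟨l, rfl⟩ : ∃ l', l = l' + 1 := ⟨l - 1, by omega⟩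
      exact h.signs.left l (by omega)
    rw [descent, ← o1, ← this, add_comm]
  rw [o1'] at t1
  exact ⟨_, _, isSplitting_splitStrip hW hj k,
    (mem_splitStrip_left_iff hW hj k).2 ⟨hbd 0 (by omega), t1⟩⟩

end

/-! ## The formal periodic points -/

section

variable {a b : ℝ} {m n : ℕ}

lemma coordSeq_theta (σ : ℤˣ) (hm : 2 ≤ m) (hn : n = 2 ∨ n = 3) (hb : 0 ≤ b)
    (hab : b + 1 < a) :
    coordSeq a b (wordSign (iota σ m n)) (theta a b σ m n) = iotaSeq m n σ a b := by
  rw [theta_eq hm (by omega) hb hab]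
  rfl

lemma admissible_theta_iff (σ : ℤˣ) (hm : 2 ≤ m) (hn : n = 2 ∨ n = 3) (hb : 0 ≤ b)
    (hab : b + 1 < a) :
    Admissible a b (iota σ m n) (theta a b σ m n) ↔
      ∀ k < m + n, 0 ≤ wordSign (iota σ m n) k * iotaSeq m n σ a b (k + 1) := by
  rw [admissible_iff, coordSeq_theta σ hm hn hb hab, length_iota σ hm (by omega)]

lemma lozi_iterate_theta {σ : ℤˣ} (hm : 2 ≤ m) (hn : n = 2 ∨ n = 3) (hb : 0 ≤ b)
    (hab : b + 1 < a) (h : Admissible a b (iota σ m n) (theta a b σ m n)) {k : ℕ}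
    (hk : k ≤ m + n) :
    ((lozi a b)^[k] (theta a b σ m n)).1 = iotaSeq m n σ a b (k + 1) := by
  rw [lozi_iterate_eq_coordSeq h (by rwa [length_iota σ hm (by omega)]),
    coordSeq_theta σ hm hn hb hab]

lemma theta_mem_leftComponent {σ : ℤˣ} (hm : 3 ≤ m) (hn : n = 2 ∨ n = 3) (hW : Wide a b)
    (h : Admissible a b (iota σ m n) (theta a b σ m n)) :
    theta a b σ m n ∈ leftComponent a b m n := by
  have hab : b + 1 < a := by linarith [hW.a_ge, hW.b_le]
  have h' := (admissible_theta_iff σ (by omega) hn hW.b_nonneg hab).1 h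
  have := mem_leftComponent (isIotaSolution_iotaSeq σ (by omega) hn hW.b_nonneg hab) hW hm h'
  rw [← coordSeq_theta σ (by omega) hn hW.b_nonneg hab] at this
  exact this

lemma hyperbolic_theta {σ : ℤˣ} (hm : 60 ≤ m) (hn : n = 2 ∨ n = 3)
    (hb : b ∈ Icc (0 : ℝ) (1 / 10000)) (ha : bifCurve m n b < a) :
    Hyperbolic a b (iota σ m n) (theta a b σ m n) := by
  have hab : b + 1 < a := by linarith [(bifCurve_spec hm hn hb).1.1, hb.2]
  have hadm := (admissible_theta_iff σ (by omega) hn hb.1 hab).2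
    fun k hk => (iotaSeq_pos σ hm hn hb ha hk).le
  refine ⟨isFormalPeriodic_theta (by omega) (by omega) hb.1 hab, hadm, fun k hk => ?_⟩
  rw [length_iota σ (by omega) (by omega)] at hk
  rw [lozi_iterate_theta (by omega) hn hb.1 hab hadm hk.le]
  exact right_ne_zero_of_mul (iotaSeq_pos σ hm hn hb ha hk).ne'

lemma admissible_theta_bifCurve (hm : 60 ≤ m) (hn : n = 2 ∨ n = 3)
    (hb : b ∈ Icc (0 : ℝ) (1 / 10000)) (σ : ℤˣ) :
    Admissible (bifCurve m n b) b (iota σ m n) (theta (bifCurve m n b) b σ m n) :=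
  (admissible_theta_iff σ (by omega) hn hb.1
    (by linarith [(bifCurve_spec hm hn hb).1.1, hb.2])).2
    fun _ hk => iotaSeq_nonneg σ hm hn hb hk

lemma lozi_iterate_theta_bifCurve (hm : 60 ≤ m) (hn : n = 2 ∨ n = 3)
    (hb : b ∈ Icc (0 : ℝ) (1 / 10000)) (σ : ℤˣ) :
    ((lozi (bifCurve m n b) b)^[m + n - 1] (theta (bifCurve m n b) b σ m n)).1 = 0 := by
  have hab : b + 1 < bifCurve m n b := by linarith [(bifCurve_spec hm hn hb).1.1, hb.2]
  rw [lozi_iterate_theta (by omega) hn hb.1 hab (admissible_theta_bifCurve hm hn hb σ)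
    (by omega), show m + n - 1 + 1 = m + n by omega,
    (isIotaSolution_iotaSeq σ (by omega) hn hb.1 hab).cyclic.per_zero]
  exact iotaSeq_bifCurve hm hn hb σ

lemma isBifurcationParameter_bifCurve (hm : 60 ≤ m) (hn : n = 2 ∨ n = 3)
    (hb : b ∈ Icc (0 : ℝ) (1 / 10000)) :
    IsBifurcationParameter (bifCurve m n b) b (iotaStem m n) := by
  have hab : b + 1 < bifCurve m n b := by linarith [(bifCurve_spec hm hn hb).1.1, hb.2]
  refine ⟨theta (bifCurve m n b) b 1 m n, fun σ => ?_, ?_⟩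
  · rw [← (theta_bifCurve_eq hm hn hb σ).1]
    exact ⟨isFormalPeriodic_theta (by omega) (by omega) hb.1 hab,
      admissible_theta_bifCurve hm hn hb σ⟩
  · rw [length_iotaStem (by omega) (by omega)]
    exact lozi_iterate_theta_bifCurve hm hn hb 1

end

end Lozi

theorem mainTheorem3 :
    ∃ bbar : ℝ, 0 < bbar ∧ bbar < 1 ∧ ∃ M : ℕ, 5 ≤ M ∧ ∃ l : ℕ → ℕ → ℝ → ℝ, ∀ m : ℕ, M ≤ m →
      (∀ n : ℕ, n = 2 ∨ n = 3 →
        AnalyticOn ℝ (l m n) (Set.Icc 0 bbar) ∧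
        Set.MapsTo (l m n) (Set.Icc 0 bbar) (Set.Ioo (√2) 4) ∧
        (∀ b ∈ Set.Icc 0 bbar, (l m n b, b) ∈ Lozi.Pnbd bbar) ∧
        ∀ (σ : ℤˣ) (a b : ℝ), (a, b) ∈ Lozi.Pnbd bbar →
          (∃! θ : ℝ × ℝ, Lozi.IsFormalPeriodic a b (Lozi.iota σ m n) θ) ∧
          (l m n b < a →
            Lozi.Hyperbolic a b (Lozi.iota σ m n) (Lozi.theta a b σ m n) ∧
            Lozi.theta a b σ m n ∈ Lozi.leftComponent a b m n) ∧
          (a = l m n b →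
            Lozi.IsBifurcationParameter a b (Lozi.iotaStem m n) ∧
            Lozi.Admissible a b (Lozi.iota σ m n) (Lozi.theta a b σ m n) ∧
            Lozi.theta a b (-1) m n = Lozi.theta a b 1 m n ∧
            Lozi.theta a b σ m n ∈ Lozi.leftComponent a b m n ∧
            ((Lozi.lozi a b)^[m + n - 1] (Lozi.theta a b σ m n)).1 = 0) ∧
          (a < l m n b →
            ¬ Lozi.Admissible a b (Lozi.iota σ m n) (Lozi.theta a b σ m n))) ∧
      ∀ b ∈ Set.Icc 0 bbar,
        derivWithin (l m 3) (Set.Icc 0 bbar) b < derivWithin (l m 2) (Set.Icc 0 bbar) b := by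
  -- The bounds 1/10000 and 60 are those built into `NearTent`.
  refine ⟨1 / 10000, by norm_num, by norm_num, 60, by norm_num, Lozi.bifCurve, fun m hm =>
    ⟨fun n hn => ⟨Lozi.analyticOn_bifCurve hm hn, fun b hb => ?_, fun b hb => ?_,
      fun σ a b hab => ?_⟩, fun b hb => Lozi.derivWithin_bifCurve_lt hm hb⟩⟩
  · have h := (Lozi.bifCurve_spec hm hn hb).1
    have h2 : √2 < 99 / 50 := by
      rw [Real.sqrt_lt' (by norm_num)]; norm_num
    exact ⟨h2.trans h.1, h.2.trans (by norm_num)⟩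
  · have h := (Lozi.bifCurve_spec hm hn hb).1
    refine ⟨⟨?_, hb.1, ?_⟩, hb⟩
    · change 3 * b + 1 < Lozi.bifCurve m n b
      linarith [h.1, hb.2]
    · exact hb.2.trans (by norm_num)
  · have hb : b ∈ Set.Icc (0 : ℝ) (1 / 10000) := hab.2
    have hP : 3 * b + 1 < a := hab.1.1
    have hb1 : b + 1 < a := by linarith [hb.1]
    have h := (Lozi.bifCurve_spec hm hn hb).1
    have hl := Lozi.length_iota σ (m := m) (n := n) (by omega) (by omega)
    refine ⟨Lozi.existsUnique_isFormalPeriodic (by omega) hb.1 hb1, fun ha => ?_, ?_,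
      fun ha => ?_⟩
    · have hyp := Lozi.hyperbolic_theta (σ := σ) hm hn hb ha
      exact ⟨hyp, Lozi.theta_mem_leftComponent (by omega) hn
        ⟨by linarith [h.1], hb.1, hb.2⟩ hyp.2.1⟩
    · rintro rfl
      have hadm := Lozi.admissible_theta_bifCurve hm hn hb σ
      exact ⟨Lozi.isBifurcationParameter_bifCurve hm hn hb, hadm,
        (Lozi.theta_bifCurve_eq hm hn hb (-1)).1,
        Lozi.theta_mem_leftComponent (by omega) hn ⟨h.1.le, hb.1, hb.2⟩ hadm,
        Lozi.lozi_iterate_theta_bifCurve hm hn hb σ⟩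
    · rw [Lozi.admissible_theta_iff σ (by omega) hn hb.1 hb1]
      exact Lozi.iotaSeq_not_nonneg σ hm hn hb hP ha
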